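/- Let $X$ be a (second countable, Hausdorff) smooth Riemannian manifold of dimension $n$, let $1\le p\le n$, and let $\mathbb G\subset G(p,TX)$ be any subset of the bundle of $p$-dimensional tangent subspaces, with fibres $\mathbb G_x\subset G(p,T_xX)$. For a $C^2$ function $\varphi$ near $x$ let $\mathrm{Hess}_x\varphi$ be its Riemannian Hessian, $(\mathrm{Hess}\,\varphi)(V,W)=VW\varphi-(\nabla_VW)\varphi$ with $\nabla$ the Levi-Civita connection, and for $W\in\mathbb G_x$ let $\mathrm{tr}_W\mathrm{Hess}_x\varphi$ be the trace of its restriction to $W$. Let $U\subset X$ be open. A test function for $u:U\to\mathbb R$ at $x\in U$ is a $C^2$ function $\varphi$ defined near $x$ with $u\le\varphi$ near $x$ and $u(x)=\varphi(x)$. An upper semicontinuous $u$ is $\mathbb G$-plurisubharmonic on $U$, written $u\in\mathrm{PSH}_{\mathbb G}(U)$, if $\mathrm{tr}_W\mathrm{Hess}_x\varphi\ge0$ for all $x\in U$, all test functions $\varphi$ for $u$ at $x$ and all $W\in\mathbb G_x$. For a function $c$, $u$ is $c$-strict on $U$ if under the same quantifiers $\mathrm{tr}_W\mathrm{Hess}_x\varphi\ge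 c(x)$. Finally $\mathrm{PSH}^\infty_{\mathbb G}(U)$ is the set of $u\in C^\infty(U)$ with $\mathrm{tr}_W\mathrm{Hess}_xu\ge0$ for all $x\in U$, $W\in\mathbb G_x$. $\mathbb G$ has the local $C^\infty$ strict approximation property if each point of $X$ has an open neighbourhood $U$ such that for every continuous $c:X\to(0,\infty)$, every $c$-strict $u\in C(U)\cap\mathrm{PSH}_{\mathbb G}(U)$, every compact $K\subset U$ and every real number $\varepsilon>0$ there is a $c$-strict $\tilde u\in\mathrm{PSH}^\infty_{\mathbb G}(U)$ with $u\le\tilde u\le u+\varepsilon$ on $K$. **Theorem 9.10 (Richberg-type approximation).** Suppose $\mathbb G$ has the local $C^\infty$ strict approximation property, and let $c,\varepsilon\in C(X)$ satisfy $c>0$ and $0<\varepsilon<1$ on $X$. If $u\in C(X)\cap\mathrm{PSH}_{\mathbb G}(X)$ is $c$-strict, then there exists $\tilde u\in\mathrm{PSH}^\infty_{\mathbb G}(X)$ which is $(1-\varepsilon)c$-strict, with $$u\le\tilde u\le u+\varepsilon\qquad\text{on }X.$$ -/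

import Mathlib

open Set Filter Topology Bundle
open scoped Manifold ContDiff

noncomputable section

namespace GPluri

/-- The model space `ℝⁿ`. -/
abbrev RSp (n : ℕ) : Type := EuclideanSpace ℝ (Fin n)

variable {n : ℕ} {X : Type*} [TopologicalSpace X] [ChartedSpace (RSp n) X]

/-- The tangent space of the `n`-manifold `X` at `x`. -/
abbrev Tan (n : ℕ) {X : Type*} [TopologicalSpace X] [ChartedSpace (RSp n) X] (x : X) : Type :=
  TangentSpace (𝓡 n) x

instance tanFiniteDimensional (x : X) : FiniteDimensional ℝ (Tan n x) :=
  inferInstanceAs (FiniteDimensional ℝ (RSp n))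

/-- The isomorphism `T_x X → ℝⁿ`, the differential at `x` of the preferred chart at `x`. -/
def chartDeriv (x : X) : Tan n x →L[ℝ] RSp n :=
  mfderiv (𝓡 n) 𝓘(ℝ, RSp n) (extChartAt (𝓡 n) x) x

/-- The differential `ℝⁿ → T_y X` at `z` of the inverse of the preferred chart at `x`, where
`y` is the point with coordinates `z`. It sends `eᵢ` to the coordinate field `∂ᵢ` at `y`. -/
def chartSymmDeriv (x : X) (z : RSp n) : RSp n →L[ℝ] Tan n ((extChartAt (𝓡 n) x).symm z) :=
  mfderiv 𝓘(ℝ, RSp n) (𝓡 n) (extChartAt (𝓡 n) x).symm z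

/-- For a Riemannian metric `g` on an open subset of `ℝⁿ` and vector fields `V, W, Z` with constant
components `v, w, ζ`, the Koszul functional `ζ ↦ ⟨∇_V W, Z⟩` at `z`. As these fields commute,
`⟨∇_V W, Z⟩ = (V⟨W, Z⟩ + W⟨V, Z⟩ - Z⟨V, W⟩) / 2`. -/
def koszul (g : RSp n → RSp n →L[ℝ] RSp n →L[ℝ] ℝ) (z v w : RSp n) : RSp n →L[ℝ] ℝ :=
  (1 / 2 : ℝ) • (fderiv ℝ g z v w + fderiv ℝ g z w v - ((fderiv ℝ g z).flip v).flip w)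

/-- The Grassmann bundle `G(p, TX)`: pairs of a point `x` and a `p`-dimensional subspace of
`T_x X`. -/
def GrassmannBundle (n p : ℕ) (X : Type*) [TopologicalSpace X] [ChartedSpace (RSp n) X] : Type _ :=
  Σ x : X, {W : Submodule ℝ (Tan n x) // Module.finrank ℝ W = p}

/-- The fibre `G_x` of a subset `G` of the Grassmann bundle. -/
def gFibre {p : ℕ} (G : Set (GrassmannBundle n p X)) (x : X) : Set (Submodule ℝ (Tan n x)) :=
  {W | ∃ h : Module.finrank ℝ W = p, (⟨x, W, h⟩ : GrassmannBundle n p X) ∈ G}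

variable [RiemannianBundle (fun x : X ↦ TangentSpace (𝓡 n) x)]

/-- The matrix `(g_ij(z))` of the Riemannian metric in the preferred chart at `x`, as a bilinear
form on `ℝⁿ`. -/
def chartMetric (x : X) (z : RSp n) : RSp n →L[ℝ] RSp n →L[ℝ] ℝ :=
  (innerSL ℝ (E := Tan n ((extChartAt (𝓡 n) x).symm z))).bilinearComp
    (chartSymmDeriv x z) (chartSymmDeriv x z)

/-- The Levi-Civita derivative `∇_V W ∈ T_x X`, where `V, W` have constant components `v, w` in
the preferred chart at `x`. -/
def leviCivita (x : X) (v w : RSp n) : Tan n x :=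
  haveI : CompleteSpace (Tan n x) := FiniteDimensional.complete ℝ (Tan n x)
  (InnerProductSpace.toDual ℝ (Tan n x)).symm
    ((koszul (chartMetric x) (extChartAt (𝓡 n) x x) v w).comp (chartDeriv x))

/-- The Riemannian Hessian `(Hess_x u)(v, w) = V W u - (∇_V W) u`, where `V, W` are the fields
through `v, w ∈ T_x X` with constant components in the preferred chart at `x`. -/
def hess (u : X → ℝ) (x : X) (v w : Tan n x) : ℝ :=
  let û : RSp n → ℝ := u ∘ (extChartAt (𝓡 n) x).symm
  let z : RSp n := extChartAt (𝓡 n) x x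
  fderiv ℝ (fun z' ↦ fderiv ℝ û z' (chartDeriv x w)) z (chartDeriv x v)
    - fderiv ℝ û z (chartDeriv x (leviCivita x (chartDeriv x v) (chartDeriv x w)))

/-- The trace over `W ⊆ T_x X` of a bilinear form `B` on `T_x X`, with respect to the Riemannian
inner product. -/
def traceOn {x : X} (W : Submodule ℝ (Tan n x)) (B : Tan n x → Tan n x → ℝ) : ℝ :=
  ∑ i, B (stdOrthonormalBasis ℝ W i : Tan n x) (stdOrthonormalBasis ℝ W i : Tan n x)

/-- `φ` is a (viscosity) test function for `u` at `x`: it is `C²` near `x`, lies above `u` near `x`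
and agrees with `u` at `x`. -/
def IsTestFunction (n : ℕ) {X : Type*} [TopologicalSpace X] [ChartedSpace (RSp n) X]
    (u φ : X → ℝ) (x : X) : Prop :=
  ContMDiffAt (𝓡 n) 𝓘(ℝ, ℝ) 2 φ x ∧ (∀ᶠ y in 𝓝 x, u y ≤ φ y) ∧ u x = φ x

/-- `u` is `c`-strict on the open set `U`: `tr_W Hess_x φ ≥ c(x)` for every `x ∈ U`, every test
function `φ` for `u` at `x` and every `W ∈ G_x`. -/
def IsStrictOn {p : ℕ} (G : Set (GrassmannBundle n p X)) (c : X → ℝ) (u : X → ℝ) (U : Set X) :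
    Prop :=
  ∀ x ∈ U, ∀ φ : X → ℝ, IsTestFunction n u φ x →
    ∀ W ∈ gFibre G x, c x ≤ traceOn W (hess φ x)

/-- `u ∈ PSH_G(U)` for a real valued function `u` and an open set `U`. -/
def IsPSHOn {p : ℕ} (G : Set (GrassmannBundle n p X)) (u : X → ℝ) (U : Set X) : Prop :=
  UpperSemicontinuousOn u U ∧
    ∀ x ∈ U, ∀ φ : X → ℝ, IsTestFunction n u φ x →
      ∀ W ∈ gFibre G x, 0 ≤ traceOn W (hess φ x)

/-- `u ∈ PSH^∞_G(U)` for an open set `U`. -/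
def IsSmoothPSHOn {p : ℕ} (G : Set (GrassmannBundle n p X)) (u : X → ℝ) (U : Set X) : Prop :=
  ContMDiffOn (𝓡 n) 𝓘(ℝ, ℝ) ∞ u U ∧
    ∀ x ∈ U, ∀ W ∈ gFibre G x, 0 ≤ traceOn W (hess u x)

/-- The local `C^∞` strict approximation property of `G`. -/
def HasLocalSmoothStrictApproximation {p : ℕ} (G : Set (GrassmannBundle n p X)) : Prop :=
  ∀ x : X, ∃ U : Set X, IsOpen U ∧ x ∈ U ∧
    ∀ c : X → ℝ, Continuous c → (∀ y, 0 < c y) →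
    ∀ u : X → ℝ, ContinuousOn u U → IsPSHOn G u U → IsStrictOn G c u U →
    ∀ K : Set X, IsCompact K → K ⊆ U → ∀ ε : ℝ, 0 < ε →
      ∃ v : X → ℝ, IsSmoothPSHOn G v U ∧ IsStrictOn G c v U ∧
        ∀ y ∈ K, u y ≤ v y ∧ v y ≤ u y + ε

end GPluri

end

/-! This is Richberg's gluing. Take a countable, locally finite sequence of bumps `ψ j` with compact
supports in sets where the local property holds, such that every point has some `ψ j = 1`. On each
support choose a smooth `c`-strict `w j` slightly above `u` and tilt it: `v j = w j + δ j * (ψ j -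
1/2)`. Since the Hessian trace of `ψ j` is bounded on its support, a small `δ j` costs at most `ε *
c` in strictness. The tilt puts `v j` well below `u` where `ψ j = 0` and well above `u` where `ψ j =
1`.

Start from any smooth `b` close to `u` and take regularized maxima with the `v j` one after another.
Where `ψ j = 0` the new function loses, so each step extends smoothly by doing nothing there. The
Hessian of a regularized maximum is at least a convex combination of the two Hessians, so strictness
survives. No Hessian bound is known for `b`, but each point is eventually lifted by some `v j`
clearly above anything `b` can reach, and there `b` has no influence. This is `exists_smooth_glued`.

The geometric input is the bound `exists_abs_traceOn_hess_le`. As `hess` uses a different chart at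
each point, it rests on a change of coordinates to a single chart. Diagonal Hessian values are
second derivatives along 2-jets of geodesics, which reduces the remaining inequalities to one real
variable. -/

/-- A smooth convex regularization of `s ↦ max 0 s`. -/
theorem exists_smooth_regularized_posPart {η : ℝ} (hη : 0 < η) :
    ∃ σ : ℝ → ℝ, ContDiff ℝ ∞ σ ∧ (∀ s, s ≤ -η → σ s = 0) ∧
      (∀ s, 0 ≤ deriv σ s ∧ deriv σ s ≤ 1) ∧ (∀ s, 0 ≤ deriv (deriv σ) s) ∧
      (∀ s, 0 < s → deriv σ s = 1 ∧ deriv (deriv σ) s = 0) ∧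
      ∀ s, s ≤ σ s ∧ 0 ≤ σ s ∧ σ s ≤ max 0 (s + η) := by
  -- This is the future `deriv σ`: it rises from 0 to 1 exactly on `[-η, 0]`. Placing the transition
  -- left of 0 makes `deriv σ = 1` as soon as `s > 0`, so a losing function drops out completely
  -- there.
  set h : ℝ → ℝ := fun t ↦ Real.smoothTransition (t / η + 1) with h_def
  have hsm : ContDiff ℝ ∞ h := Real.smoothTransition.contDiff.comp (by fun_prop)
  have hc : Continuous h := hsm.continuous
  have hmono : Monotone h := fun s t hst ↦ Real.smoothTransition.monotone (by gcongr)
  have h0 : ∀ s, s ≤ -η → h s = 0 := fun s hs ↦ Real.smoothTransition.zero_of_nonpos (by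
    have : s / η ≤ -1 := by rw [div_le_iff₀ hη]; linarith
    linarith)
  have h1 : ∀ s, 0 ≤ s → h s = 1 := fun s hs ↦ Real.smoothTransition.one_of_one_le (by
    have : 0 ≤ s / η := by positivity
    linarith)
  have hnn : ∀ s, 0 ≤ h s := fun s ↦ Real.smoothTransition.nonneg _
  have hle : ∀ s, h s ≤ 1 := fun s ↦ Real.smoothTransition.le_one _
  set σ : ℝ → ℝ := fun s ↦ ∫ t in (-η)..s, h t with σ_def
  have hd : ∀ s, HasDerivAt σ (h s) s := fun s ↦
    intervalIntegral.integral_hasDerivAt_right (hc.intervalIntegrable _ _)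
      (hc.stronglyMeasurableAtFilter _ _) hc.continuousAt
  have hderiv : deriv σ = h := funext fun s ↦ (hd s).deriv
  have hσmono : Monotone σ := monotone_of_deriv_nonneg (fun s ↦ (hd s).differentiableAt)
    (by simpa [hderiv] using hnn)
  have hds : ∀ s, HasDerivAt (fun s ↦ σ s - s) (h s - 1) s := fun s ↦ (hd s).sub (hasDerivAt_id s)
  have hanti : Antitone (fun s ↦ σ s - s) :=
    antitone_of_deriv_nonpos (fun s ↦ (hds s).differentiableAt)
      (fun s ↦ by rw [(hds s).deriv]; linarith [hle s])
  have hz : ∀ s, s ≤ -η → σ s = 0 := fun s hs ↦ by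
    rw [σ_def]
    simp only
    rw [intervalIntegral.integral_congr (g := fun _ ↦ (0 : ℝ))]
    · simp
    · intro t ht
      rw [uIcc_of_ge hs] at ht
      exact h0 t ht.2
  have hpos : ∀ s, 0 ≤ σ s := fun s ↦ by
    rcases le_total s (-η) with hs | hs
    · exact (hz s hs).ge
    · exact (hz _ le_rfl).ge.trans (hσmono hs)
  refine ⟨σ, ?_, hz, fun s ↦ by rw [hderiv]; exact ⟨hnn s, hle s⟩, ?_, ?_, ?_⟩
  · exact contDiff_infty_iff_deriv.2 ⟨fun s ↦ (hd s).differentiableAt, hderiv ▸ hsm⟩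
  · rw [hderiv]; exact fun s ↦ hmono.deriv_nonneg
  · intro s hs
    rw [hderiv]
    refine ⟨h1 s hs.le, ?_⟩
    have : h =ᶠ[𝓝 s] fun _ ↦ 1 := by
      filter_upwards [lt_mem_nhds hs] with t ht using h1 t ht.le
    rw [this.deriv_eq, deriv_const]
  · intro s
    refine ⟨?_, hpos s, ?_⟩
    · rcases le_total s 0 with hs | hs
      · exact hs.trans (hpos s)
      · have hm : MonotoneOn (fun s ↦ σ s - s) (Ici 0) :=
          monotoneOn_of_deriv_nonneg (convex_Ici 0)
            (fun s _ ↦ (hds s).continuousAt.continuousWithinAt)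
            (fun s _ ↦ (hds s).differentiableAt.differentiableWithinAt)
            (fun s hs ↦ by
              rw [interior_Ici] at hs
              rw [(hds s).deriv, h1 s (le_of_lt hs)]; simp)
        have := hm (mem_Ici.2 le_rfl) hs hs
        have h2 := hpos 0
        simp only at this
        linarith
    · rcases le_total s (-η) with hs | hs
      · rw [hz s hs]; exact le_max_left _ _
      · have := hanti hs
        simp only [hz _ le_rfl] at this
        exact le_max_of_le_right (by linarith)

/-! ### Calculus along curves and under changes of coordinates -/

theorem deriv_deriv_comp_curve {E F : Type*} [NormedAddCommGroup E] [NormedSpace ℝ E]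
    [NormedAddCommGroup F] [NormedSpace ℝ F] {f : E → F} {k : ℝ → E} {t : ℝ}
    (hf : ContDiffAt ℝ 2 f (k t)) (hk : ContDiffAt ℝ 2 k t) :
    deriv (deriv (f ∘ k)) t =
      fderiv ℝ (fderiv ℝ f) (k t) (deriv k t) (deriv k t) + fderiv ℝ f (k t) (deriv (deriv k) t) := by
  have hfd : ∀ᶠ s in 𝓝 t, DifferentiableAt ℝ f (k s) :=
    hk.continuousAt.eventually ((hf.eventually (by simp)).mono fun y hy ↦
      hy.differentiableAt (by simp))
  have hkd : ∀ᶠ s in 𝓝 t, DifferentiableAt ℝ k s :=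
    (hk.eventually (by simp)).mono fun y hy ↦ hy.differentiableAt (by simp)
  have heq : deriv (f ∘ k) =ᶠ[𝓝 t] fun s ↦ fderiv ℝ f (k s) (deriv k s) := by
    filter_upwards [hfd, hkd] with s h1 h2
    exact (h1.hasFDerivAt.comp_hasDerivAt s h2.hasDerivAt).deriv
  have h1 : HasFDerivAt (fderiv ℝ f) (fderiv ℝ (fderiv ℝ f) (k t)) (k t) :=
    ((hf.fderiv_right (m := 1) (by norm_num)).differentiableAt (by simp)).hasFDerivAt
  have h2 : HasDerivAt k (deriv k t) t := (hk.differentiableAt (by simp)).hasDerivAt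
  have h3 : HasDerivAt (deriv k) (deriv (deriv k) t) t := by
    have : ContDiffAt ℝ 1 (deriv k) t := by
      have := (hk.fderiv_right (m := 1) (by norm_num)).clm_apply (contDiffAt_const (c := (1 : ℝ)))
      simpa only [fderiv_apply_one_eq_deriv] using this
    exact (this.differentiableAt (by simp)).hasDerivAt
  rw [heq.deriv_eq]
  exact ((h1.comp_hasDerivAt t h2).clm_apply h3).deriv

/-- A negative second derivative at a critical point would give a local maximum as well, so `f`
would be locally constant and its second derivative zero. -/
theorem deriv_deriv_nonneg_of_isLocalMin {f : ℝ → ℝ} {t : ℝ} (hf : ContDiffAt ℝ 2 f t)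
    (h : IsLocalMin f t) : 0 ≤ deriv (deriv f) t := by
  by_contra! hlt
  have hd := h.deriv_eq_zero
  have hmax := isLocalMax_of_deriv_deriv_neg hlt hd hf.continuousAt
  have : f =ᶠ[𝓝 t] fun _ ↦ f t := by
    filter_upwards [h, hmax] with s h1 h2 using le_antisymm h2 h1
  have h0 : deriv f =ᶠ[𝓝 t] fun _ ↦ 0 := by
    filter_upwards [this.deriv] with s hs
    rw [hs]; simp
  rw [h0.deriv_eq] at hlt
  simp at hlt

theorem contDiffAt_of_clm_apply {D E F : Type*} [NormedAddCommGroup D] [NormedSpace ℝ D]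
    [NormedAddCommGroup E] [NormedSpace ℝ E] [FiniteDimensional ℝ E] [NormedAddCommGroup F]
    [NormedSpace ℝ F] {m : WithTop ℕ∞} {f : D → E →L[ℝ] F} {x : D}
    (h : ∀ y, ContDiffAt ℝ m (fun x ↦ f x y) x) : ContDiffAt ℝ m f x := by
  let d := Module.finrank ℝ E
  have hd : d = Module.finrank ℝ (Fin d → ℝ) := (Module.finrank_fin_fun ℝ).symm
  let e₁ := ContinuousLinearEquiv.ofFinrankEq hd
  let e₂ := (e₁.arrowCongr (1 : F ≃L[ℝ] F)).trans (ContinuousLinearEquiv.piRing (Fin d))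
  rw [← Function.id_comp f, ← e₂.symm_comp_self]
  exact e₂.symm.contDiff.contDiffAt.comp x (contDiffAt_pi.mpr fun i ↦ h _)

set_option synthInstance.maxHeartbeats 200000 in
/-- The derivative of the pullback `g'` of a family `g` of bilinear forms by a map `τ`. -/
theorem fderiv_pullback_bilin {E : Type*} [NormedAddCommGroup E] [NormedSpace ℝ E]
    [FiniteDimensional ℝ E] {g g' : E → E →L[ℝ] E →L[ℝ] ℝ} {τ : E → E} {z : E}
    (hτ : ContDiffAt ℝ 2 τ z) (hg : ContDiffAt ℝ 1 g (τ z))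
    (hgg : ∀ᶠ y in 𝓝 z, ∀ v w, g' y v w = g (τ y) (fderiv ℝ τ y v) (fderiv ℝ τ y w))
    (e v w : E) : fderiv ℝ g' z e v w =
      fderiv ℝ g (τ z) (fderiv ℝ τ z e) (fderiv ℝ τ z v) (fderiv ℝ τ z w) +
      g (τ z) (fderiv ℝ (fderiv ℝ τ) z e v) (fderiv ℝ τ z w) +
      g (τ z) (fderiv ℝ τ z v) (fderiv ℝ (fderiv ℝ τ) z e w) := by
  have hDτ : ContDiffAt ℝ 1 (fderiv ℝ τ) z := hτ.fderiv_right (by norm_num)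
  have hgτ : ContDiffAt ℝ 1 (fun y ↦ g (τ y)) z := hg.comp z (hτ.of_le (by norm_num))
  have hg'd : ∀ v w, HasFDerivAt (fun y ↦ g (τ y) (fderiv ℝ τ y v) (fderiv ℝ τ y w))
      (fderiv ℝ (fun y ↦ g' y v w) z) z := fun v w ↦ by
    have : (fun y ↦ g' y v w) =ᶠ[𝓝 z] fun y ↦ g (τ y) (fderiv ℝ τ y v) (fderiv ℝ τ y w) :=
      hgg.mono fun y hy ↦ hy v w
    rw [this.fderiv_eq]
    exact (((hgτ.clm_apply (hDτ.clm_apply contDiffAt_const)).clm_apply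
      (hDτ.clm_apply contDiffAt_const)).differentiableAt (by simp)).hasFDerivAt
  have hg' : ContDiffAt ℝ 1 g' z := by
    refine contDiffAt_of_clm_apply fun v ↦ contDiffAt_of_clm_apply fun w ↦ ?_
    refine ((hgτ.clm_apply (hDτ.clm_apply contDiffAt_const)).clm_apply
      (hDτ.clm_apply contDiffAt_const)).congr_of_eventuallyEq (hgg.mono fun y hy ↦ hy v w)
  have h1 := (hg'.differentiableAt one_ne_zero).hasFDerivAt
  have h2 := (h1.clm_apply (hasFDerivAt_const v z)).clm_apply (hasFDerivAt_const w z)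
  have hD : HasFDerivAt (fderiv ℝ τ) (fderiv ℝ (fderiv ℝ τ) z) z :=
    (hDτ.differentiableAt (by simp)).hasFDerivAt
  have hG : HasFDerivAt (fun y ↦ g (τ y)) ((fderiv ℝ g (τ z)).comp (fderiv ℝ τ z)) z :=
    (hg.differentiableAt (by simp)).hasFDerivAt.comp z
      (hτ.differentiableAt (by simp)).hasFDerivAt
  have h3 := (hG.clm_apply (hD.clm_apply (hasFDerivAt_const v z))).clm_apply
    (hD.clm_apply (hasFDerivAt_const w z))
  have h4 := h3.unique (hg'd v w)
  rw [h2.fderiv] at h4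
  have := congrArg (fun L ↦ L e) h4
  simp at this
  rw [← this]
  ring

namespace GPluri

/-- Transformation of the geodesic acceleration under a change of coordinates `τ`. -/
theorem koszul_change_coordinates {n : ℕ} {g g' : RSp n → RSp n →L[ℝ] RSp n →L[ℝ] ℝ}
    {τ : RSp n → RSp n} {z : RSp n} (hτ : ContDiffAt ℝ 2 τ z) (hg : ContDiffAt ℝ 1 g (τ z))
    (hsymm : ∀ v w, g (τ z) v w = g (τ z) w v)
    (hgg : ∀ᶠ y in 𝓝 z, ∀ v w, g' y v w = g (τ y) (fderiv ℝ τ y v) (fderiv ℝ τ y w))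
    {a γ : RSp n} (hγ : ∀ ζ, g' z γ ζ = koszul g' z a a ζ)
    (hA : Function.Surjective (fderiv ℝ τ z)) (ζ : RSp n) :
    g (τ z) (fderiv ℝ τ z γ - fderiv ℝ (fderiv ℝ τ) z a a) ζ =
      koszul g (τ z) (fderiv ℝ τ z a) (fderiv ℝ τ z a) ζ := by
  obtain ⟨b, rfl⟩ := hA ζ
  have hsec : IsSymmSndFDerivAt ℝ τ z := hτ.isSymmSndFDerivAt (by simp)
  have hd := fderiv_pullback_bilin hτ hg hgg
  have h0 := hγ b
  have hgz := hgg.self_of_nhds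
  simp only [koszul, smul_apply, sub_apply,
    add_apply, ContinuousLinearMap.flip_apply, hd, hgz, smul_eq_mul,
    map_sub] at h0 ⊢
  -- By symmetry of the second derivative of `τ`, all its terms cancel except the one in direction
  -- `(a, a)`: the usual inhomogeneous term for Christoffel symbols.
  rw [h0, hsec b a, hsymm (fderiv ℝ (fderiv ℝ τ) z a b)]
  ring

end GPluri

/-! ### Preferred charts, transition maps and the metric in coordinates -/

namespace GPluri

variable {n : ℕ} {X : Type*} [TopologicalSpace X] [ChartedSpace (RSp n) X]
  [IsManifold (𝓡 n) ∞ X]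

theorem chartDeriv_apply (x : X) (v : Tan n x) : chartDeriv x v = v := by
  unfold chartDeriv
  rw [mfderiv_extChartAt_self]
  rfl

theorem chartSymmDeriv_center_apply (x : X) (v : RSp n) :
    chartSymmDeriv x (extChartAt (𝓡 n) x x) v = v := by
  unfold chartSymmDeriv
  have := mfderivWithin_range_extChartAt_symm (I := 𝓡 n) (x := x)
  rw [modelWithCornersSelf_coe, range_id, mfderivWithin_univ] at this
  rw [this]
  rfl

theorem contMDiffAt_extChartAt_symm (x : X) {z : RSp n} (hz : z ∈ (extChartAt (𝓡 n) x).target) :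
    ContMDiffAt 𝓘(ℝ, RSp n) (𝓡 n) ∞ (extChartAt (𝓡 n) x).symm z :=
  (contMDiffOn_extChartAt_symm x).contMDiffAt ((isOpen_extChartAt_target x).mem_nhds hz)

theorem mfderiv_extChartAt_chartSymmDeriv (x : X) {z : RSp n}
    (hz : z ∈ (extChartAt (𝓡 n) x).target) (v : RSp n) :
    mfderiv (𝓡 n) 𝓘(ℝ, RSp n) (extChartAt (𝓡 n) x) ((extChartAt (𝓡 n) x).symm z)
      (chartSymmDeriv x z v) = v := by
  have := mfderiv_extChartAt_comp_mfderivWithin_extChartAt_symm (I := 𝓡 n) hz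
  rw [modelWithCornersSelf_coe, range_id, mfderivWithin_univ] at this
  exact congrArg (fun L : RSp n →L[ℝ] RSp n ↦ L v) this

/-- The transition map from the preferred chart at `y` to the preferred chart at `x`. -/
noncomputable def chartChange (x y : X) : RSp n → RSp n := extChartAt (𝓡 n) x ∘ (extChartAt (𝓡 n) y).symm

theorem contDiffAt_chartChange (x y : X) {z : RSp n} (hz : z ∈ (extChartAt (𝓡 n) y).target)
    (hzx : (extChartAt (𝓡 n) y).symm z ∈ (extChartAt (𝓡 n) x).source) :
    ContDiffAt ℝ ∞ (chartChange x y) z := by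
  have := contDiffWithinAt_ext_coord_change (I := 𝓡 n) (n := ∞) x y (y := z)
    ⟨by simpa using hz, hzx⟩
  rwa [modelWithCornersSelf_coe, range_id, contDiffWithinAt_univ] at this

theorem fderiv_chartChange_center (x y : X) (hy : y ∈ (extChartAt (𝓡 n) x).source) (v : RSp n) :
    fderiv ℝ (chartChange x y) (extChartAt (𝓡 n) y y) v =
      mfderiv (𝓡 n) 𝓘(ℝ, RSp n) (extChartAt (𝓡 n) x) y v := by
  rw [← mfderiv_eq_fderiv, chartChange]
  have hyc : (extChartAt (𝓡 n) y).symm (extChartAt (𝓡 n) y y) = y := extChartAt_to_inv y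
  rw [mfderiv_comp (I' := 𝓡 n)]
  · refine (congrArg _ (chartSymmDeriv_center_apply y v)).trans ?_
    rw [hyc]
    rfl
  · rw [hyc]
    exact mdifferentiableAt_extChartAt (by simpa using hy)
  · exact (contMDiffAt_extChartAt_symm y (mem_extChartAt_target y)).mdifferentiableAt (by simp)

theorem fderiv_chartChange_center_surjective (x y : X) (hy : y ∈ (extChartAt (𝓡 n) x).source) :
    Function.Surjective (fderiv ℝ (chartChange x y) (extChartAt (𝓡 n) y y)) := fun v ↦ by
  obtain ⟨w, hw⟩ := (isInvertible_mfderiv_extChartAt hy).bijective.surjective v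
  exact ⟨w, (fderiv_chartChange_center x y hy w).trans hw⟩

theorem chartSymmDeriv_change (x y : X) {z : RSp n}
    (hz : z ∈ (extChartAt (𝓡 n) y).target)
    (hzx : (extChartAt (𝓡 n) y).symm z ∈ (extChartAt (𝓡 n) x).source) (v : RSp n) :
    (chartSymmDeriv y z v : RSp n) = chartSymmDeriv x (chartChange x y z)
      (fderiv ℝ (chartChange x y) z v) := by
  have heq : (extChartAt (𝓡 n) y).symm =ᶠ[𝓝 z] (extChartAt (𝓡 n) x).symm ∘ chartChange x y := by
    have h := (continuousAt_extChartAt_symm'' hz).preimage_mem_nhds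
      ((isOpen_extChartAt_source x).mem_nhds hzx)
    filter_upwards [h] with z' hz'
    exact ((extChartAt (𝓡 n) x).left_inv hz').symm
  have hd := contDiffAt_chartChange x y hz hzx
  unfold chartSymmDeriv
  rw [heq.mfderiv_eq, mfderiv_comp (I' := 𝓘(ℝ, RSp n)), mfderiv_eq_fderiv]
  · rfl
  · exact (contMDiffAt_extChartAt_symm x ((extChartAt (𝓡 n) x).map_source hzx)).mdifferentiableAt
      (by simp)
  · exact (hd.differentiableAt (by simp)).mdifferentiableAt

variable [RiemannianBundle (fun x : X ↦ TangentSpace (𝓡 n) x)]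

/-- The Riemannian metric at `p`, on vectors given by their components in the preferred chart
at `p`. -/
noncomputable def metricForm (p : X) (v w : RSp n) : ℝ := innerSL ℝ (E := Tan n p) v w

omit [IsManifold (𝓡 n) ∞ X] in
theorem chartMetric_apply (x : X) (z v w : RSp n) :
    chartMetric x z v w = metricForm ((extChartAt (𝓡 n) x).symm z) (chartSymmDeriv x z v)
      (chartSymmDeriv x z w) := rfl

theorem chartMetric_center (x : X) (v w : RSp n) :
    chartMetric x (extChartAt (𝓡 n) x x) v w = metricForm x v w := by
  rw [chartMetric_apply, chartSymmDeriv_center_apply, chartSymmDeriv_center_apply,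
    extChartAt_to_inv]

theorem metricForm_leviCivita (x : X) (v w ζ : RSp n) :
    metricForm x (leviCivita x v w) ζ = koszul (chartMetric x) (extChartAt (𝓡 n) x x) v w ζ := by
  have : CompleteSpace (Tan n x) := FiniteDimensional.complete ℝ (Tan n x)
  refine (InnerProductSpace.toDual_symm_apply (𝕜 := ℝ) (E := Tan n x) (x := ζ)
    (y := (koszul (chartMetric x) (extChartAt (𝓡 n) x x) v w).comp (chartDeriv x))).trans ?_
  exact congrArg (koszul (chartMetric x) (extChartAt (𝓡 n) x x) v w) (chartDeriv_apply x ζ)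

theorem chartMetric_change (x y : X) {z : RSp n}
    (hz : z ∈ (extChartAt (𝓡 n) y).target)
    (hzx : (extChartAt (𝓡 n) y).symm z ∈ (extChartAt (𝓡 n) x).source) (v w : RSp n) :
    chartMetric y z v w = chartMetric x (chartChange x y z)
      (fderiv ℝ (chartChange x y) z v) (fderiv ℝ (chartChange x y) z w) := by
  rw [chartMetric_apply, chartMetric_apply, chartSymmDeriv_change x y hz hzx,
    chartSymmDeriv_change x y hz hzx, chartChange, Function.comp_apply,
    (extChartAt (𝓡 n) x).left_inv hzx]

omit [IsManifold (𝓡 n) ∞ X] in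
theorem metricForm_comm (p : X) (v w : RSp n) : metricForm p v w = metricForm p w v :=
  real_inner_comm (F := Tan n p) w v

/-- Coordinate fields of the chart at `x` are constant in the trivialization at `x`, hence smooth
sections, and the metric pairs smooth sections smoothly. -/
theorem contDiffAt_chartMetric [IsContMDiffRiemannianBundle (𝓡 n) ∞ (RSp n)
    (fun x : X ↦ TangentSpace (𝓡 n) x)] (x : X) :
    ContDiffAt ℝ ∞ (chartMetric x) (extChartAt (𝓡 n) x x) := by
  have hsec : ∀ v : RSp n, ContMDiffAt 𝓘(ℝ, RSp n) ((𝓡 n).prod 𝓘(ℝ, RSp n)) ∞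
      (fun z ↦ (⟨(extChartAt (𝓡 n) x).symm z, chartSymmDeriv x z v⟩ :
        TotalSpace (RSp n) (fun x : X ↦ TangentSpace (𝓡 n) x))) (extChartAt (𝓡 n) x x) := by
    intro v
    rw [contMDiffAt_totalSpace]
    refine ⟨contMDiffAt_extChartAt_symm x (mem_extChartAt_target x), ?_⟩
    refine (contMDiffAt_const (c := v)).congr_of_eventuallyEq ?_
    filter_upwards [extChartAt_target_mem_nhds (I := 𝓡 n) x] with z hz
    have hs : (extChartAt (𝓡 n) x).symm z ∈ (chartAt (RSp n) x).source := by
      simpa using (extChartAt (𝓡 n) x).map_target hz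
    have h1 := mfderiv_extChartAt_chartSymmDeriv x hz v
    rw [← TangentBundle.continuousLinearMapAt_trivializationAt hs] at h1
    rw [extChartAt_to_inv]
    refine Eq.trans ?_ h1
    refine (congrFun (Trivialization.coe_linearMapAt_of_mem (R := ℝ)
      (trivializationAt (RSp n) (TangentSpace (𝓡 n)) x) ?_) _).symm
    simpa using hs
  refine contDiffAt_of_clm_apply fun v ↦ contDiffAt_of_clm_apply fun w ↦ ?_
  exact ((hsec v).inner_bundle (hsec w)).contDiffAt

end GPluri

/-! ### The Hessian as a second derivative along geodesic jets -/

namespace GPluri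

variable {n : ℕ} {X : Type*} [TopologicalSpace X] [ChartedSpace (RSp n) X]
  [IsManifold (𝓡 n) ∞ X]

omit [IsManifold (𝓡 n) ∞ X] in
theorem contDiffAt_comp_extChartAt_symm {m : WithTop ℕ∞} {φ : X → ℝ} {x : X}
    (hφ : ContMDiffAt (𝓡 n) 𝓘(ℝ, ℝ) m φ x) :
    ContDiffAt ℝ m (φ ∘ (extChartAt (𝓡 n) x).symm) (extChartAt (𝓡 n) x x) := by
  have := (contMDiffAt_iff.1 hφ).2
  rwa [modelWithCornersSelf_coe, range_id, contDiffWithinAt_univ] at this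

theorem contDiffAt_comp_extChartAt_symm' {φ : X → ℝ} {x y : X}
    (hy : y ∈ (extChartAt (𝓡 n) x).source) (hφ : ContMDiffAt (𝓡 n) 𝓘(ℝ, ℝ) 2 φ y) :
    ContDiffAt ℝ 2 (φ ∘ (extChartAt (𝓡 n) x).symm) (extChartAt (𝓡 n) x y) := by
  have h := (contMDiffAt_extChartAt_symm x ((extChartAt (𝓡 n) x).map_source hy)).of_le
    (m := 2) (by norm_cast)
  refine ContMDiffAt.contDiffAt (ContMDiffAt.comp _ ?_ h)
  rwa [(extChartAt (𝓡 n) x).left_inv hy]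

variable [RiemannianBundle (fun x : X ↦ TangentSpace (𝓡 n) x)]

/-- The components of `∇_V V` at `x`, where `V` has constant components `v` in the preferred chart
at `x`. -/
noncomputable def covAccel (x : X) (v : RSp n) : RSp n := leviCivita x v v

/-- The 2-jet at `0` of the geodesic through `x` with velocity `v`, in the preferred chart
at `x`. -/
noncomputable def coordJet (x : X) (v : RSp n) (t : ℝ) : RSp n :=
  extChartAt (𝓡 n) x x + (t • v - (t ^ 2 / 2) • covAccel x v)

omit [IsManifold (𝓡 n) ∞ X] in
theorem coordJet_zero (x : X) (v : RSp n) : coordJet x v 0 = extChartAt (𝓡 n) x x := by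
  simp [coordJet]

omit [IsManifold (𝓡 n) ∞ X] in
theorem contDiff_coordJet (x : X) (v : RSp n) : ContDiff ℝ 2 (coordJet x v) := by
  unfold coordJet
  fun_prop

omit [IsManifold (𝓡 n) ∞ X] in
theorem deriv_coordJet (x : X) (v : RSp n) :
    deriv (coordJet x v) = fun t ↦ v - t • covAccel x v := by
  funext t
  have h1 : HasDerivAt (fun t : ℝ ↦ t • v) v t := by
    simpa using (hasDerivAt_id t).smul_const v
  have h2 : HasDerivAt (fun t : ℝ ↦ t ^ 2 / 2) t t := by
    have := ((hasDerivAt_id t).pow 2).div_const 2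
    simpa using this
  exact ((h1.sub (h2.smul_const (covAccel x v))).const_add _).deriv

omit [IsManifold (𝓡 n) ∞ X] in
theorem deriv_deriv_coordJet_zero (x : X) (v : RSp n) :
    deriv (deriv (coordJet x v)) 0 = -covAccel x v := by
  rw [deriv_coordJet]
  have h1 : HasDerivAt (fun t : ℝ ↦ t • covAccel x v) (covAccel x v) 0 := by
    simpa using (hasDerivAt_id (0 : ℝ)).smul_const (covAccel x v)
  simpa using (h1.const_sub v).deriv

theorem hess_self_apply (φ : X → ℝ) (x : X) (v : RSp n) :
    hess φ x v v = fderiv ℝ (fun z ↦ fderiv ℝ (φ ∘ (extChartAt (𝓡 n) x).symm) z v)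
        (extChartAt (𝓡 n) x x) v -
      fderiv ℝ (φ ∘ (extChartAt (𝓡 n) x).symm) (extChartAt (𝓡 n) x x) (covAccel x v) := by
  have h : (chartDeriv x : RSp n →L[ℝ] RSp n) = ContinuousLinearMap.id ℝ (RSp n) :=
    ContinuousLinearMap.ext (chartDeriv_apply x)
  -- Abstracting `chartDeriv x` as an endomorphism of `RSp n` lets it be rewritten to the identity
  -- at all occurrences.
  change (fun D : RSp n →L[ℝ] RSp n ↦
    fderiv ℝ (fun z ↦ fderiv ℝ (φ ∘ (extChartAt (𝓡 n) x).symm) z (D v))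
        (extChartAt (𝓡 n) x x) (D v) -
      fderiv ℝ (φ ∘ (extChartAt (𝓡 n) x).symm) (extChartAt (𝓡 n) x x)
        (D (leviCivita x (D v) (D v)))) (chartDeriv x) = _
  rw [h]
  rfl

/-- The jet has velocity `v` and acceleration `-covAccel x v`, so the chain rule yields exactly the
two terms of the Hessian. -/
theorem hess_eq_deriv_deriv {φ : X → ℝ} {x : X} (hφ : ContMDiffAt (𝓡 n) 𝓘(ℝ, ℝ) 2 φ x)
    (v : RSp n) :
    hess φ x v v = deriv (deriv ((φ ∘ (extChartAt (𝓡 n) x).symm) ∘ coordJet x v)) 0 := by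
  have hφ' := contDiffAt_comp_extChartAt_symm hφ
  rw [deriv_deriv_comp_curve (by rwa [coordJet_zero]) (contDiff_coordJet x v).contDiffAt,
    coordJet_zero, deriv_deriv_coordJet_zero, deriv_coordJet]
  have h1 : HasFDerivAt (fderiv ℝ (φ ∘ (extChartAt (𝓡 n) x).symm)) _ (extChartAt (𝓡 n) x x) :=
    ((hφ'.fderiv_right (m := 1) (by norm_num)).differentiableAt (by simp)).hasFDerivAt
  have h2 := (h1.clm_apply (hasFDerivAt_const (v : RSp n) _)).fderiv
  rw [hess_self_apply, h2]
  simp [sub_eq_add_neg]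

omit [IsManifold (𝓡 n) ∞ X] in
theorem chartMetric_comm (x : X) (z v w : RSp n) :
    chartMetric x z v w = chartMetric x z w v :=
  (chartMetric_apply x z v w).trans
    ((metricForm_comm _ (chartSymmDeriv x z v : RSp n) (chartSymmDeriv x z w : RSp n)).trans
      (chartMetric_apply x z w v).symm)

/-- The Hessian at `y` computed in the preferred chart at a nearby point `x`. -/
theorem hess_eq_of_mem_source (x y : X) (hy : y ∈ (extChartAt (𝓡 n) x).source)
    (hg : ContDiffAt ℝ 1 (chartMetric x) (extChartAt (𝓡 n) x y)) (v : RSp n) :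
    ∃ β : RSp n, let α : RSp n := mfderiv (𝓡 n) 𝓘(ℝ, RSp n) (extChartAt (𝓡 n) x) y v
      (∀ ζ, chartMetric x (extChartAt (𝓡 n) x y) β ζ =
        -koszul (chartMetric x) (extChartAt (𝓡 n) x y) α α ζ) ∧
      ∀ φ : X → ℝ, ContMDiffAt (𝓡 n) 𝓘(ℝ, ℝ) 2 φ y → hess φ y v v =
        fderiv ℝ (fderiv ℝ (φ ∘ (extChartAt (𝓡 n) x).symm)) (extChartAt (𝓡 n) x y) α α +
          fderiv ℝ (φ ∘ (extChartAt (𝓡 n) x).symm) (extChartAt (𝓡 n) x y) β := by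
  set τ : RSp n → RSp n := chartChange x y with hτ_def
  set z := extChartAt (𝓡 n) y y with hz_def
  have hzt : z ∈ (extChartAt (𝓡 n) y).target := mem_extChartAt_target y
  have hzy : (extChartAt (𝓡 n) y).symm z = y := extChartAt_to_inv y
  have hτz : τ z = extChartAt (𝓡 n) x y := congrArg (extChartAt (𝓡 n) x) hzy
  have hev : ∀ᶠ z' in 𝓝 z, z' ∈ (extChartAt (𝓡 n) y).target ∧
      (extChartAt (𝓡 n) y).symm z' ∈ (extChartAt (𝓡 n) x).source := by
    refine Filter.Eventually.and (extChartAt_target_mem_nhds (I := 𝓡 n) y)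
      ((continuousAt_extChartAt_symm'' hzt).preimage_mem_nhds
        ((isOpen_extChartAt_source x).mem_nhds (by rwa [hzy])))
  have hτ : ContDiffAt ℝ 2 τ z :=
    (contDiffAt_chartChange x y hzt (by rwa [hzy])).of_le (by norm_cast)
  have hα : fderiv ℝ τ z v = mfderiv (𝓡 n) 𝓘(ℝ, RSp n) (extChartAt (𝓡 n) x) y v :=
    fderiv_chartChange_center x y hy v
  -- This is the acceleration at 0 of the jet at `y` transported by `τ`; `α` is its velocity.
  refine ⟨fderiv ℝ (fderiv ℝ τ) z v v - fderiv ℝ τ z (covAccel y v), ?_, ?_⟩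
  · intro ζ
    rw [← hα, ← hτz]
    have := koszul_change_coordinates (g := chartMetric x) (g' := chartMetric y) (τ := τ) (z := z)
      (a := v) (γ := covAccel y v) hτ (by rwa [hτz])
      (chartMetric_comm x (τ z))
      (hev.mono fun z' hz' v w ↦ chartMetric_change x y hz'.1 hz'.2 v w)
      (fun ζ ↦ by rw [chartMetric_center, covAccel, metricForm_leviCivita])
      (fderiv_chartChange_center_surjective x y hy) ζ
    rw [← this, ← neg_sub, map_neg]
    rfl
  · intro φ hφ
    have hφx := contDiffAt_comp_extChartAt_symm' hy hφ
    have hk := (contDiff_coordJet y v).contDiffAt (x := 0)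
    have hk0 : coordJet y v 0 = z := coordJet_zero y v
    have heq : (φ ∘ (extChartAt (𝓡 n) y).symm) ∘ coordJet y v =ᶠ[𝓝 0]
        (φ ∘ (extChartAt (𝓡 n) x).symm) ∘ (τ ∘ coordJet y v) := by
      have h := hk.continuousAt
      rw [ContinuousAt, hk0] at h
      filter_upwards [h.eventually hev] with t ht
      exact congrArg φ ((extChartAt (𝓡 n) x).left_inv ht.2).symm
    have hτk : ContDiffAt ℝ 2 (τ ∘ coordJet y v) 0 := ContDiffAt.comp 0 (by rwa [hk0]) hk
    have hd1 : deriv (τ ∘ coordJet y v) 0 = fderiv ℝ τ z v := by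
      rw [fderiv_comp_deriv _ (by rw [hk0]; exact hτ.differentiableAt (by simp))
        (hk.differentiableAt (by simp)), hk0, deriv_coordJet]
      simp
    rw [hess_eq_deriv_deriv hφ, heq.deriv.deriv_eq, deriv_deriv_comp_curve (by
      rwa [Function.comp_apply, hk0, hτz]) hτk, hd1, Function.comp_apply, hk0, hτz, hα,
      deriv_deriv_comp_curve (by rwa [hk0]) hk, hk0, deriv_deriv_coordJet_zero, deriv_coordJet]
    simp
    rfl

end GPluri

/-! ### Local and compact bounds for the Hessian -/

theorem eventually_norm_fderiv_apply_le {E F : Type*} [NormedAddCommGroup E] [NormedSpace ℝ E]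
    [NormedAddCommGroup F] [NormedSpace ℝ F] {g : E → F} {z : E} (hg : ContDiffAt ℝ 1 g z) :
    ∃ D : ℝ, 0 ≤ D ∧ ∀ᶠ y in 𝓝 z, ∀ a, ‖fderiv ℝ g y a‖ ≤ D * ‖a‖ := by
  have hc : ContinuousAt (fderiv ℝ g) z := (hg.fderiv_right (m := 0) (by norm_num)).continuousAt
  refine ⟨‖fderiv ℝ g z‖ + 1, by positivity, ?_⟩
  filter_upwards [hc.norm.eventually (gt_mem_nhds (lt_add_one _))] with y hy a
  exact (fderiv ℝ g y).le_of_opNorm_le hy.le a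

theorem abs_bilin_le {E : Type*} [NormedAddCommGroup E] [NormedSpace ℝ E]
    {L : E →L[ℝ] E →L[ℝ] ℝ} {D : ℝ} (hL : ‖L‖ ≤ D) (b c : E) : |L b c| ≤ D * ‖b‖ * ‖c‖ := by
  rw [← Real.norm_eq_abs]
  exact (L b).le_of_opNorm_le (L.le_of_opNorm_le hL b) c

theorem eventually_abs_fderiv_bilin_le {E : Type*} [NormedAddCommGroup E] [NormedSpace ℝ E]
    {g : E → E →L[ℝ] E →L[ℝ] ℝ} {z : E} (hg : ContDiffAt ℝ 1 g z) :
    ∃ D : ℝ, 0 ≤ D ∧ ∀ᶠ y in 𝓝 z, ∀ a b c, |fderiv ℝ g y a b c| ≤ D * ‖a‖ * ‖b‖ * ‖c‖ := by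
  obtain ⟨D, hD, h⟩ := eventually_norm_fderiv_apply_le hg
  exact ⟨D, hD, h.mono fun y hy a b c ↦ abs_bilin_le (hy a) b c⟩

namespace GPluri

theorem abs_koszul_self_le {n : ℕ} {g : RSp n → RSp n →L[ℝ] RSp n →L[ℝ] ℝ} {z : RSp n} {D : ℝ}
    (hD : 0 ≤ D) (key : ∀ a b c, |fderiv ℝ g z a b c| ≤ D * ‖a‖ * ‖b‖ * ‖c‖) (v ζ : RSp n) :
    |koszul g z v v ζ| ≤ 2 * D * ‖v‖ ^ 2 * ‖ζ‖ := by
  have h : koszul g z v v ζ = fderiv ℝ g z v v ζ - 1 / 2 * fderiv ℝ g z ζ v v := by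
    simp only [koszul, smul_apply, sub_apply, add_apply, ContinuousLinearMap.flip_apply,
      smul_eq_mul]
    ring
  have h1 := abs_le.1 (key v v ζ)
  have h2 := abs_le.1 (key ζ v v)
  have h3 : 0 ≤ D * ‖v‖ * ‖v‖ * ‖ζ‖ := by positivity
  rw [h, abs_le]
  constructor <;> nlinarith

variable {n : ℕ} {X : Type*} [TopologicalSpace X] [ChartedSpace (RSp n) X]
  [IsManifold (𝓡 n) ∞ X]

/-- The components in the preferred chart at `x` of a tangent vector at `y`. -/
noncomputable def coordVel (x y : X) (v : RSp n) : RSp n :=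
  mfderiv (𝓡 n) 𝓘(ℝ, RSp n) (extChartAt (𝓡 n) x) y v

variable [RiemannianBundle (fun x : X ↦ TangentSpace (𝓡 n) x)]
  [IsContMDiffRiemannianBundle (𝓡 n) ∞ (RSp n) (fun x : X ↦ TangentSpace (𝓡 n) x)]

theorem eventually_norm_mfderiv_extChartAt_apply_le (x : X) :
    ∃ C : ℝ, 0 < C ∧ ∀ᶠ y in 𝓝 x, ∀ v : Tan n y, ‖coordVel x y v‖ ≤ C * ‖v‖ := by
  have : IsContinuousRiemannianBundle (RSp n) (fun x : X ↦ TangentSpace (𝓡 n) x) := by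
    obtain ⟨g, hg, hgi⟩ := IsContMDiffRiemannianBundle.exists_contMDiff (IB := 𝓡 n) (n := ∞)
      (F := RSp n) (E := fun x : X ↦ TangentSpace (𝓡 n) x)
    exact ⟨g, hg.continuous, hgi⟩
  obtain ⟨C, hC, h⟩ := eventually_norm_trivializationAt_lt (RSp n)
    (fun x : X ↦ TangentSpace (𝓡 n) x) x
  refine ⟨C, hC, ?_⟩
  filter_upwards [h, chart_source_mem_nhds (RSp n) x] with y hy hys v
  rw [TangentBundle.continuousLinearMapAt_trivializationAt hys] at hy
  exact ContinuousLinearMap.le_of_opNorm_le (E := Tan n y) (F := RSp n) _ hy.le v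

/-- In the fixed chart at `x` the derivatives of `φ` and of the metric are bounded near `x`. The
velocity is bounded by `‖v‖`, and the geodesic equation bounds the acceleration by the square of the
velocity. -/
theorem eventually_abs_hess_self_le {φ : X → ℝ} (hφ : ContMDiff (𝓡 n) 𝓘(ℝ, ℝ) 2 φ) (x : X) :
    ∃ C : ℝ, ∀ᶠ y in 𝓝 x, ∀ v : Tan n y, |hess φ y v v| ≤ C * ‖v‖ ^ 2 := by
  obtain ⟨C₀, hC₀, hev⟩ := eventually_norm_mfderiv_extChartAt_apply_le (n := n) x
  set e := extChartAt (𝓡 n) x with he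
  have hcont : ContinuousAt e x := continuousAt_extChartAt x
  have hg := contDiffAt_chartMetric (n := n) x
  have hg1 : ContDiffAt ℝ 1 (chartMetric x) (e x) := hg.of_le (by norm_cast)
  have hφx := contDiffAt_comp_extChartAt_symm (hφ x)
  have hφ1 : ContDiffAt ℝ 1 (fderiv ℝ (φ ∘ e.symm)) (e x) := hφx.fderiv_right (by norm_num)
  have hφ2 : ContDiffAt ℝ 0 (fderiv ℝ (fderiv ℝ (φ ∘ e.symm))) (e x) :=
    hφ1.fderiv_right (by norm_num)
  obtain ⟨D, hD0, hDg⟩ := eventually_abs_fderiv_bilin_le hg1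
  have bdd : ∀ {F : Type} [NormedAddCommGroup F] (f : RSp n → F), ContinuousAt f (e x) →
      ∀ᶠ y in 𝓝 x, ‖f (e y)‖ ≤ ‖f (e x)‖ + 1 := fun f hf ↦
    ((ContinuousAt.comp (f := e) hf hcont).norm.eventually
      (gt_mem_nhds (lt_add_one _))).mono fun y hy ↦ hy.le
  set A := ‖fderiv ℝ (fderiv ℝ (φ ∘ e.symm)) (e x)‖ + 1
  set B := ‖fderiv ℝ (φ ∘ e.symm) (e x)‖ + 1 with hB
  have hB0 : 0 ≤ B := by positivity
  have hA0 : 0 ≤ A := by positivity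
  refine ⟨(A + B * (2 * C₀ ^ 2 * D)) * C₀ ^ 2, ?_⟩
  filter_upwards [hev, bdd _ hφ2.continuousAt, bdd _ hφ1.continuousAt, hcont.eventually hDg,
    extChartAt_source_mem_nhds (I := 𝓡 n) x,
    hcont.eventually (hg1.eventually (by simp))] with y h0 h2 h1 hD hy hgy v
  obtain ⟨β, hβ, hess_eq⟩ := hess_eq_of_mem_source x y hy hgy v
  set α : RSp n := coordVel x y v with hα
  change (∀ ζ, chartMetric x (e y) β ζ = -koszul (chartMetric x) (e y) α α ζ) at hβ
  change (∀ φ : X → ℝ, ContMDiffAt (𝓡 n) 𝓘(ℝ, ℝ) 2 φ y → hess φ y v v =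
    fderiv ℝ (fderiv ℝ (φ ∘ e.symm)) (e y) α α + fderiv ℝ (φ ∘ e.symm) (e y) β) at hess_eq
  have hαv : ‖α‖ ≤ C₀ * ‖v‖ := h0 v
  -- Uniform ellipticity of the metric in the chart. Applied to `ζ = β`, it turns the equation for
  -- `chartMetric x (e y) β` into a bound on `‖β‖`.
  have hell : ∀ ζ : RSp n, ‖ζ‖ ^ 2 ≤ C₀ ^ 2 * chartMetric x (e y) ζ ζ := fun ζ ↦ by
    have hey : e.symm (e y) = y := e.left_inv hy
    have h0' : ∀ v : Tan n (e.symm (e y)),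
        ‖coordVel x (e.symm (e y)) v‖ ≤ C₀ * ‖v‖ := by rw [hey]; exact h0
    have h3 := h0' (chartSymmDeriv x (e y) ζ)
    have h5 : coordVel x (e.symm (e y)) (chartSymmDeriv x (e y) ζ) = ζ :=
      mfderiv_extChartAt_chartSymmDeriv x (e.map_source hy) ζ
    rw [h5] at h3
    have h4 : chartMetric x (e y) ζ ζ = ‖chartSymmDeriv x (e y) ζ‖ ^ 2 :=
      real_inner_self_eq_norm_sq (F := Tan n (e.symm (e y))) _
    rw [h4, ← mul_pow]
    gcongr
  have hβα : ‖β‖ ≤ 2 * C₀ ^ 2 * D * ‖α‖ ^ 2 := by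
    have h3 := hell β
    rw [hβ] at h3
    have h4 := (neg_le_abs _).trans (abs_koszul_self_le hD0 hD α β)
    rcases (norm_nonneg β).eq_or_lt with h6 | h6
    · rw [← h6]; positivity
    · refine le_of_mul_le_mul_right ?_ h6
      calc ‖β‖ * ‖β‖ = ‖β‖ ^ 2 := by ring
        _ ≤ C₀ ^ 2 * (2 * D * ‖α‖ ^ 2 * ‖β‖) := h3.trans (by gcongr)
        _ = _ := by ring
  rw [hess_eq φ (hφ y), ← Real.norm_eq_abs]
  have e1 : ‖fderiv ℝ (fderiv ℝ (φ ∘ e.symm)) (e y) α α‖ ≤ A * ‖α‖ ^ 2 := by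
    refine ((fderiv ℝ (fderiv ℝ (φ ∘ e.symm)) (e y) α).le_opNorm α).trans ?_
    rw [pow_two, ← mul_assoc]
    gcongr
    refine ((fderiv ℝ (fderiv ℝ (φ ∘ e.symm)) (e y)).le_opNorm α).trans ?_
    gcongr
  have e2 : ‖fderiv ℝ (φ ∘ e.symm) (e y) β‖ ≤ B * (2 * C₀ ^ 2 * D * ‖α‖ ^ 2) := by
    refine ((fderiv ℝ (φ ∘ e.symm) (e y)).le_opNorm β).trans ?_
    gcongr
  refine (norm_add_le _ _).trans ((add_le_add e1 e2).trans ?_)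
  have : ‖α‖ ^ 2 ≤ C₀ ^ 2 * ‖v‖ ^ 2 := by rw [← mul_pow]; gcongr
  calc A * ‖α‖ ^ 2 + B * (2 * C₀ ^ 2 * D * ‖α‖ ^ 2)
      = (A + B * (2 * C₀ ^ 2 * D)) * ‖α‖ ^ 2 := by ring
    _ ≤ (A + B * (2 * C₀ ^ 2 * D)) * (C₀ ^ 2 * ‖v‖ ^ 2) := by gcongr
    _ = _ := by ring

theorem exists_abs_hess_self_le {φ : X → ℝ} (hφ : ContMDiff (𝓡 n) 𝓘(ℝ, ℝ) 2 φ) {K : Set X}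
    (hK : IsCompact K) : ∃ C : ℝ, ∀ y ∈ K, ∀ v : Tan n y, |hess φ y v v| ≤ C * ‖v‖ ^ 2 := by
  refine hK.induction_on (p := fun s ↦ ∃ C : ℝ, ∀ y ∈ s, ∀ v : Tan n y,
    |hess φ y v v| ≤ C * ‖v‖ ^ 2) ⟨0, by simp⟩ ?_ ?_ ?_
  · rintro s t hst ⟨C, hC⟩
    exact ⟨C, fun y hy ↦ hC y (hst hy)⟩
  · rintro s t ⟨C, hC⟩ ⟨C', hC'⟩
    refine ⟨max C C', ?_⟩
    rintro y (hy | hy) v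
    · exact (hC y hy v).trans (by gcongr; exact le_max_left _ _)
    · exact (hC' y hy v).trans (by gcongr; exact le_max_right _ _)
  · intro x _
    obtain ⟨C, hC⟩ := eventually_abs_hess_self_le hφ x
    exact ⟨_, mem_nhdsWithin_of_mem_nhds hC, C, fun y hy ↦ hy⟩

theorem exists_abs_traceOn_hess_le {p : ℕ} (G : Set (GrassmannBundle n p X)) {φ : X → ℝ}
    (hφ : ContMDiff (𝓡 n) 𝓘(ℝ, ℝ) 2 φ) {K : Set X} (hK : IsCompact K) :
    ∃ C : ℝ, 0 < C ∧ ∀ y ∈ K, ∀ W ∈ gFibre G y, |traceOn W (hess φ y)| ≤ C := by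
  obtain ⟨C, hC⟩ := exists_abs_hess_self_le hφ hK
  refine ⟨p * |C| + 1, by positivity, ?_⟩
  rintro y hy W ⟨hW, -⟩
  unfold traceOn
  refine (Finset.abs_sum_le_sum_abs _ _).trans ?_
  refine (Finset.sum_le_card_nsmul _ _ |C| fun i _ ↦ ?_).trans ?_
  · have h1 : ‖((stdOrthonormalBasis ℝ W i : W) : Tan n y)‖ = 1 :=
      (stdOrthonormalBasis ℝ W).norm_eq_one i
    refine (hC y hy _).trans ?_
    rw [h1]
    simpa using le_abs_self C
  · simp [hW]

end GPluri

/-! ### Hessian inequalities: regularized maxima and test functions -/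

theorem ContDiffAt.hasDerivAt_deriv {f : ℝ → ℝ} {t : ℝ} (hf : ContDiffAt ℝ 2 f t) :
    HasDerivAt (deriv f) (deriv (deriv f) t) t := by
  have : ContDiffAt ℝ 1 (deriv f) t := by
    have := (hf.fderiv_right (m := 1) (by norm_num)).clm_apply (contDiffAt_const (c := (1 : ℝ)))
    simpa only [fderiv_apply_one_eq_deriv] using this
  exact (this.differentiableAt (by simp)).hasDerivAt

theorem ContDiffAt.eventually_hasDerivAt {f : ℝ → ℝ} {t : ℝ} (hf : ContDiffAt ℝ 2 f t) :
    ∀ᶠ s in 𝓝 t, HasDerivAt f (deriv f s) s :=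
  (hf.eventually (by simp)).mono fun _ hs ↦ (hs.differentiableAt (by simp)).hasDerivAt

theorem deriv_deriv_add_mul {f g : ℝ → ℝ} {t : ℝ} (hf : ContDiffAt ℝ 2 f t)
    (hg : ContDiffAt ℝ 2 g t) (a b : ℝ) :
    deriv (deriv fun s ↦ f s + a * (g s - b)) t = deriv (deriv f) t + a * deriv (deriv g) t := by
  have h : (deriv fun s ↦ f s + a * (g s - b)) =ᶠ[𝓝 t] fun s ↦ deriv f s + a * deriv g s := by
    filter_upwards [hf.eventually_hasDerivAt, hg.eventually_hasDerivAt] with s h1 h2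
    exact (h1.add ((h2.sub_const b).const_mul a)).deriv
  rw [h.deriv_eq]
  exact (hf.hasDerivAt_deriv.add (hg.hasDerivAt_deriv.const_mul a)).deriv

/-- The discarded term is `σ''` times the square of `g' - f'`, nonnegative by convexity of `σ`. -/
theorem le_deriv_deriv_add_comp_sub {f g σ : ℝ → ℝ} {t : ℝ} (hf : ContDiffAt ℝ 2 f t)
    (hg : ContDiffAt ℝ 2 g t) (hσ : ContDiff ℝ 2 σ) (hσ2 : 0 ≤ deriv (deriv σ) (g t - f t)) :
    (1 - deriv σ (g t - f t)) * deriv (deriv f) t + deriv σ (g t - f t) * deriv (deriv g) t ≤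
      deriv (deriv fun s ↦ f s + σ (g s - f s)) t := by
  have h : (deriv fun s ↦ f s + σ (g s - f s)) =ᶠ[𝓝 t]
      fun s ↦ deriv f s + deriv σ (g s - f s) * (deriv g s - deriv f s) := by
    filter_upwards [hf.eventually_hasDerivAt, hg.eventually_hasDerivAt] with s h1 h2
    have h3 : HasDerivAt σ (deriv σ (g s - f s)) (g s - f s) :=
      (hσ.differentiable (by simp)).differentiableAt.hasDerivAt
    exact (h1.add (h3.comp s (h2.sub h1))).deriv
  have h1 := hf.eventually_hasDerivAt.self_of_nhds
  have h2 := hg.eventually_hasDerivAt.self_of_nhds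
  have h3 := (hσ.contDiffAt (x := g t - f t)).hasDerivAt_deriv
  have h4 := (hf.hasDerivAt_deriv.add ((h3.comp t (h2.sub h1)).mul
    (hg.hasDerivAt_deriv.sub hf.hasDerivAt_deriv))).deriv
  rw [h.deriv_eq]
  refine le_of_le_of_eq ?_ h4.symm
  simp only [Function.comp_apply, Pi.sub_apply]
  nlinarith [mul_nonneg hσ2 (sq_nonneg (deriv g t - deriv f t))]

namespace GPluri

variable {n : ℕ} {X : Type*} [TopologicalSpace X] [ChartedSpace (RSp n) X]
  [RiemannianBundle (fun x : X ↦ TangentSpace (𝓡 n) x)]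

/-- `φ` along the 2-jet of the geodesic through `x` with velocity `v`. -/
noncomputable def alongJet (φ : X → ℝ) (x : X) (v : RSp n) : ℝ → ℝ :=
  (φ ∘ (extChartAt (𝓡 n) x).symm) ∘ coordJet x v

theorem alongJet_zero (φ : X → ℝ) (x : X) (v : RSp n) : alongJet φ x v 0 = φ x := by
  simp [alongJet, coordJet_zero]

theorem contDiffAt_alongJet {φ : X → ℝ} {x : X} (hφ : ContMDiffAt (𝓡 n) 𝓘(ℝ, ℝ) 2 φ x)
    (v : RSp n) : ContDiffAt ℝ 2 (alongJet φ x v) 0 := by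
  have h := contDiffAt_comp_extChartAt_symm hφ
  exact ContDiffAt.comp 0 (by rwa [coordJet_zero]) (contDiff_coordJet x v).contDiffAt

theorem eventually_alongJet {P : X → Prop} {x : X} (h : ∀ᶠ y in 𝓝 x, P y) (v : RSp n) :
    ∀ᶠ t in 𝓝 0, P ((extChartAt (𝓡 n) x).symm (coordJet x v t)) := by
  have h1 : Tendsto (coordJet x v) (𝓝 0) (𝓝 (extChartAt (𝓡 n) x x)) := by
    have := (contDiff_coordJet x v).continuous.tendsto 0
    rwa [coordJet_zero] at this
  have h2 := continuousAt_extChartAt_symm (I := 𝓡 n) x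
  rw [ContinuousAt, extChartAt_to_inv] at h2
  exact (h2.comp h1).eventually h

variable [IsManifold (𝓡 n) ∞ X]

theorem hess_self_congr {φ ψ : X → ℝ} {x : X} (h : φ =ᶠ[𝓝 x] ψ) (v : RSp n) :
    hess φ x v v = hess ψ x v v := by
  have h2 := continuousAt_extChartAt_symm (I := 𝓡 n) x
  rw [ContinuousAt, extChartAt_to_inv] at h2
  have h3 : φ ∘ (extChartAt (𝓡 n) x).symm =ᶠ[𝓝 (extChartAt (𝓡 n) x x)]
    ψ ∘ (extChartAt (𝓡 n) x).symm := h2.eventually h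
  have h4 : (fun z ↦ fderiv ℝ (φ ∘ (extChartAt (𝓡 n) x).symm) z v)
      =ᶠ[𝓝 (extChartAt (𝓡 n) x x)]
      fun z ↦ fderiv ℝ (ψ ∘ (extChartAt (𝓡 n) x).symm) z (v : RSp n) :=
    h3.fderiv.mono fun z hz ↦ congrArg (fun L : RSp n →L[ℝ] ℝ ↦ L v) hz
  refine (hess_self_apply φ x v).trans (Eq.trans ?_ (hess_self_apply ψ x v).symm)
  rw [h4.fderiv_eq, h3.fderiv_eq]

theorem hess_self_add_mul {φ ψ : X → ℝ} {x : X} (hφ : ContMDiffAt (𝓡 n) 𝓘(ℝ, ℝ) 2 φ x)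
    (hψ : ContMDiffAt (𝓡 n) 𝓘(ℝ, ℝ) 2 ψ x) (a b : ℝ)
    (hs : ContMDiffAt (𝓡 n) 𝓘(ℝ, ℝ) 2 (fun y ↦ φ y + a * (ψ y - b)) x) (v : RSp n) :
    hess (fun y ↦ φ y + a * (ψ y - b)) x v v = hess φ x v v + a * hess ψ x v v := by
  refine (hess_eq_deriv_deriv hs v).trans ?_
  refine Eq.trans ?_ (congrArg₂ (fun r s ↦ r + a * s) (hess_eq_deriv_deriv hφ v)
    (hess_eq_deriv_deriv hψ v)).symm
  exact deriv_deriv_add_mul (contDiffAt_alongJet hφ v) (contDiffAt_alongJet hψ v) a b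

theorem hess_self_regularized_max_ge {φ ψ : X → ℝ} {x : X}
    (hφ : ContMDiffAt (𝓡 n) 𝓘(ℝ, ℝ) 2 φ x) (hψ : ContMDiffAt (𝓡 n) 𝓘(ℝ, ℝ) 2 ψ x)
    {σ : ℝ → ℝ} (hσ : ContDiff ℝ 2 σ) (hσ2 : ∀ s, 0 ≤ deriv (deriv σ) s)
    (hs : ContMDiffAt (𝓡 n) 𝓘(ℝ, ℝ) 2 (fun y ↦ φ y + σ (ψ y - φ y)) x) (v : RSp n) :
    (1 - deriv σ (ψ x - φ x)) * hess φ x v v + deriv σ (ψ x - φ x) * hess ψ x v v ≤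
      hess (fun y ↦ φ y + σ (ψ y - φ y)) x v v := by
  have h := le_deriv_deriv_add_comp_sub (contDiffAt_alongJet hφ v) (contDiffAt_alongJet hψ v) hσ
    (hσ2 _)
  rw [alongJet_zero, alongJet_zero] at h
  refine le_of_eq_of_le ?_ (h.trans (hess_eq_deriv_deriv hs v).ge)
  exact (congrArg₂ (fun r s ↦ (1 - deriv σ (ψ x - φ x)) * r + deriv σ (ψ x - φ x) * s)
    (hess_eq_deriv_deriv hφ v) (hess_eq_deriv_deriv hψ v))

/-- Along a geodesic jet `φ - u` has a local minimum at 0. Thus a pointwise trace bound for a smooth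
function implies strictness in the viscosity sense. -/
theorem hess_self_le_of_isTestFunction {u φ : X → ℝ} {x : X}
    (hu : ContMDiffAt (𝓡 n) 𝓘(ℝ, ℝ) 2 u x) (hφ : IsTestFunction n u φ x) (v : RSp n) :
    hess u x v v ≤ hess φ x v v := by
  obtain ⟨hφ1, hle, heq⟩ := hφ
  have h1 := contDiffAt_alongJet hφ1 v
  have h2 := contDiffAt_alongJet hu v
  have hmin : IsLocalMin (fun t ↦ alongJet φ x v t + (-1) * (alongJet u x v t - 0)) 0 := by
    filter_upwards [eventually_alongJet hle v] with t ht
    simp only [alongJet_zero, heq]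
    simp only [alongJet, Function.comp_apply]
    linarith
  have h3 := deriv_deriv_nonneg_of_isLocalMin
    (h1.add (contDiffAt_const.mul (h2.sub contDiffAt_const))) hmin
  rw [deriv_deriv_add_mul h1 h2] at h3
  refine (hess_eq_deriv_deriv hu v).trans_le (le_trans ?_ (hess_eq_deriv_deriv hφ1 v).ge)
  change deriv (deriv (alongJet u x v)) 0 ≤ deriv (deriv (alongJet φ x v)) 0
  linarith

omit [IsManifold (𝓡 n) ∞ X] in
theorem traceOn_le_of_combination {x : X} (W : Submodule ℝ (Tan n x))
    {B B₁ B₂ : Tan n x → Tan n x → ℝ} (a b : ℝ) (h : ∀ v, a * B₁ v v + b * B₂ v v ≤ B v v) :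
    a * traceOn W B₁ + b * traceOn W B₂ ≤ traceOn W B := by
  unfold traceOn
  rw [Finset.mul_sum, Finset.mul_sum, ← Finset.sum_add_distrib]
  exact Finset.sum_le_sum fun i _ ↦ h _

omit [IsManifold (𝓡 n) ∞ X] in
theorem traceOn_mono {x : X} (W : Submodule ℝ (Tan n x))
    {B B' : Tan n x → Tan n x → ℝ} (h : ∀ v, B v v ≤ B' v v) : traceOn W B ≤ traceOn W B' :=
  Finset.sum_le_sum fun _ _ ↦ h _

theorem traceOn_hess_congr {φ ψ : X → ℝ} {x : X} (h : φ =ᶠ[𝓝 x] ψ)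
    (W : Submodule ℝ (Tan n x)) : traceOn W (hess φ x) = traceOn W (hess ψ x) :=
  Finset.sum_congr rfl fun _ _ ↦ hess_self_congr h _

omit [IsManifold (𝓡 n) ∞ X]
  [RiemannianBundle (fun x : X ↦ TangentSpace (𝓡 n) x)] in
theorem isTestFunction_self {u : X → ℝ} {x : X} (hu : ContMDiffAt (𝓡 n) 𝓘(ℝ, ℝ) 2 u x) :
    IsTestFunction n u u x :=
  ⟨hu, Eventually.of_forall fun _ ↦ le_rfl, rfl⟩

end GPluri

/-! ### Gap functions, bump sequences and the gluing -/

theorem IsCompact.exists_pos_forall_le {X : Type*} [TopologicalSpace X] {K : Set X}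
    (hK : IsCompact K) {g : X → ℝ} (hg : ContinuousOn g K) (hpos : ∀ x ∈ K, 0 < g x) :
    ∃ s : ℝ, 0 < s ∧ ∀ x ∈ K, s ≤ g x := by
  rcases K.eq_empty_or_nonempty with rfl | hne
  · exact ⟨1, one_pos, by simp⟩
  · obtain ⟨x, hx, hmin⟩ := hK.exists_isMinOn hne hg
    exact ⟨g x, hpos x hx, fun y hy ↦ hmin hy⟩

/-- Locally only finitely many of the constraints are active, so a small positive constant meets
them; the constraints are convex, and a partition of unity patches the constants. -/
theorem exists_continuous_gap {X : Type*} [TopologicalSpace X] [NormalSpace X]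
    [ParacompactSpace X] {T : ℕ → Set X} (hT : LocallyFinite T) {δ : ℕ → ℝ}
    (hδ : ∀ j, 0 < δ j) {ε : X → ℝ} (hε : Continuous ε) (hε0 : ∀ x, 0 < ε x) :
    ∃ g : X → ℝ, Continuous g ∧ (∀ x, 0 < g x) ∧ (∀ x, g x ≤ ε x) ∧
      ∀ j, ∀ x ∈ T j, g x ≤ δ j := by
  obtain ⟨g, hg⟩ := exists_continuous_forall_mem_convex_of_local_const
    (t := fun x ↦ Ioc 0 (ε x) ∩ ⋂ j, ⋂ (_ : x ∈ T j), Iic (δ j))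
    (fun x ↦ (convex_Ioc _ _).inter (convex_iInter₂ fun _ _ ↦ convex_Iic _)) (fun x ↦ by
      obtain ⟨t, ht, hfin⟩ := hT x
      have h1 : ∀ᶠ r : ℝ in 𝓝[>] 0, ∀ j ∈ {j | (T j ∩ t).Nonempty}, r < δ j :=
        (Filter.eventually_all_finite hfin).2 fun j _ ↦
          mem_nhdsWithin_of_mem_nhds (gt_mem_nhds (hδ j))
      have h2 : ∀ᶠ r : ℝ in 𝓝[>] 0, r < ε x := mem_nhdsWithin_of_mem_nhds (gt_mem_nhds (hε0 x))
      obtain ⟨r, ⟨hr1, hr2⟩, hr0⟩ := ((h1.and h2).and self_mem_nhdsWithin).exists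
      refine ⟨r, ?_⟩
      filter_upwards [ht, hε.continuousAt.eventually (lt_mem_nhds hr2)] with y hy hyε
      exact ⟨⟨hr0, hyε.le⟩, mem_iInter₂.2 fun j hj ↦ (hr1 j ⟨y, hj, hy⟩).le⟩)
  exact ⟨g, g.continuous, fun x ↦ (hg x).1.1, fun x ↦ (hg x).1.2,
    fun j x hx ↦ mem_iInter₂.1 (hg x).2 j hx⟩

namespace GPluri

variable {n : ℕ} {X : Type*} [TopologicalSpace X] [T2Space X] [SecondCountableTopology X]
  [ChartedSpace (RSp n) X] [IsManifold (𝓡 n) ∞ X]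

theorem exists_smooth_bump_sequence (U : X → Set X) (hU : ∀ x, U x ∈ 𝓝 x) :
    ∃ ψ : ℕ → X → ℝ, (∀ j, ContMDiff (𝓡 n) 𝓘(ℝ, ℝ) ∞ (ψ j)) ∧
      (∀ j x, 0 ≤ ψ j x ∧ ψ j x ≤ 1) ∧ (∀ j, HasCompactSupport (ψ j)) ∧
      LocallyFinite (fun j ↦ tsupport (ψ j)) ∧ (∀ x, ∃ j, ψ j x = 1) ∧
      ∀ j, tsupport (ψ j) = ∅ ∨ ∃ x, tsupport (ψ j) ⊆ U x := by
  classical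
  have : LocallyCompactSpace X := ChartedSpace.locallyCompactSpace (RSp n) X
  obtain ⟨ι, f, hf⟩ := SmoothBumpCovering.exists_isSubordinate (𝓡 n) (s := (univ : Set X))
    isClosed_univ (U := U) fun x _ ↦ hU x
  have hcount : Countable ι := countable_univ_iff.1
    (f.locallyFinite.countable_univ fun i ↦ (f i).nonempty_support)
  obtain ⟨e, he⟩ := exists_injective_nat ι
  -- The gluing is an induction on `ℕ`, so the countable cover is reindexed; unused indices carry
  -- the zero function, whose support is empty.
  let ψ : ℕ → X → ℝ := fun j ↦ if h : ∃ i, e i = j then f h.choose else 0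
  have hψe : ∀ i, ψ (e i) = f i := fun i ↦ by
    have h : ∃ i', e i' = e i := ⟨i, rfl⟩
    simp only [ψ, dif_pos h]
    rw [he h.choose_spec]
  have hψ : ∀ j, ψ j = 0 ∨ ∃ i, e i = j ∧ ψ j = f i := fun j ↦ by
    by_cases h : ∃ i, e i = j
    · obtain ⟨i, rfl⟩ := h
      exact Or.inr ⟨i, rfl, hψe i⟩
    · exact Or.inl (by simp [ψ, h])
  have hlf : LocallyFinite fun j ↦ Function.support (ψ j) := by
    intro x
    obtain ⟨t, ht, hfin⟩ := f.locallyFinite x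
    refine ⟨t, ht, (hfin.image e).subset ?_⟩
    rintro j ⟨y, hy, hyt⟩
    rcases hψ j with h | ⟨i, rfl, h⟩
    · exact absurd (congrFun h y) hy
    · exact ⟨i, ⟨y, by simpa only [Function.mem_support, h] using hy, hyt⟩, rfl⟩
  refine ⟨ψ, fun j ↦ ?_, fun j x ↦ ?_, fun j ↦ ?_, hlf.closure, fun x ↦ ?_, fun j ↦ ?_⟩
  · rcases hψ j with h | ⟨i, -, h⟩
    · rw [h]; exact contMDiff_const
    · rw [h]; exact (f i).contMDiff
  · rcases hψ j with h | ⟨i, -, h⟩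
    · rw [h]; simp
    · rw [h]; exact ⟨(f i).nonneg, (f i).le_one⟩
  · rcases hψ j with h | ⟨i, -, h⟩
    · rw [h]; exact HasCompactSupport.zero
    · rw [h]; exact (f i).hasCompactSupport
  · obtain ⟨i, hi⟩ := f.eventuallyEq_one' x (mem_univ x)
    exact ⟨e i, by rw [hψe]; exact hi.self_of_nhds⟩
  · rcases hψ j with h | ⟨i, -, h⟩
    · left; rw [h]; exact tsupport_eq_empty_iff.2 rfl
    · right; rw [h]; exact ⟨_, hf i⟩

theorem exists_smooth_approx {u g : X → ℝ} (hu : Continuous u) (hg : Continuous g)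
    (hg0 : ∀ x, 0 < g x) :
    ∃ b : X → ℝ, ContMDiff (𝓡 n) 𝓘(ℝ, ℝ) ∞ b ∧ ∀ x, u x - g x < b x ∧ b x < u x + g x := by
  have : LocallyCompactSpace X := ChartedSpace.locallyCompactSpace (RSp n) X
  obtain ⟨b, hb⟩ := exists_contMDiffMap_forall_mem_convex_of_local_const (𝓡 n) (n := ⊤)
    (t := fun x ↦ Ioo (u x - g x) (u x + g x)) (fun x ↦ convex_Ioo _ _) (fun x ↦ ⟨u x, by
      filter_upwards [(hu.sub hg).continuousAt.eventually
        (gt_mem_nhds (show u x - g x < u x by linarith [hg0 x])),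
        (hu.add hg).continuousAt.eventually
        (lt_mem_nhds (show u x < u x + g x by linarith [hg0 x]))] with y h1 h2 using ⟨h1, h2⟩⟩)
  exact ⟨b, b.contMDiff, hb⟩

variable [RiemannianBundle (fun x : X ↦ TangentSpace (𝓡 n) x)]

/-- Richberg's gluing of smooth local approximations. -/
theorem exists_smooth_glued {p : ℕ} (G : Set (GrassmannBundle n p X)) {u ε κ : X → ℝ}
    (hu : Continuous u) (hε : Continuous ε) (hε0 : ∀ x, 0 < ε x) {ψ : ℕ → X → ℝ}
    (hψ : ∀ j, ContMDiff (𝓡 n) 𝓘(ℝ, ℝ) ∞ (ψ j)) (hψ01 : ∀ j x, 0 ≤ ψ j x ∧ ψ j x ≤ 1)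
    (hψc : ∀ j, HasCompactSupport (ψ j)) (hlf : LocallyFinite fun j ↦ tsupport (ψ j))
    (hψ1 : ∀ x, ∃ j, ψ j x = 1) {δ : ℕ → ℝ} (hδ : ∀ j, 0 < δ j)
    (hδε : ∀ j, ∀ x ∈ tsupport (ψ j), δ j ≤ ε x)
    (happrox : ∀ j, ∀ s : ℝ, 0 < s → ∃ U : Set X, IsOpen U ∧ tsupport (ψ j) ⊆ U ∧
      ∃ w : X → ℝ, ContMDiffOn (𝓡 n) 𝓘(ℝ, ℝ) ∞ w U ∧
        ∀ x ∈ tsupport (ψ j), u x ≤ w x ∧ w x ≤ u x + s ∧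
          ∀ W ∈ gFibre G x, κ x ≤ traceOn W (hess (fun y ↦ w y + δ j * (ψ j y - 1 / 2)) x)) :
    ∃ v : X → ℝ, ContMDiff (𝓡 n) 𝓘(ℝ, ℝ) ∞ v ∧
      (∀ x, ∀ W ∈ gFibre G x, κ x ≤ traceOn W (hess v x)) ∧
      ∀ x, u x ≤ v x ∧ v x ≤ u x + ε x := by
  classical
  have : LocallyCompactSpace X := ChartedSpace.locallyCompactSpace (RSp n) X
  -- `g` is the unit of closeness: `ε ≥ 4g` everywhere, and on the support of `ψ j` the tilt `δ j /
  -- 2` is at least `4g`.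
  obtain ⟨g, hgc, hg0, hgε, hgδ⟩ := exists_continuous_gap hlf
    (δ := fun j ↦ δ j / 8) (fun j ↦ by linarith [hδ j]) (hε.div_const 4)
    (fun x ↦ by linarith [hε0 x])
  obtain ⟨b, hb, hbu⟩ := exists_smooth_approx (n := n) hu hgc hg0
  choose s hs0 hsg using fun j ↦ IsCompact.exists_pos_forall_le (hψc j) hgc.continuousOn
    (fun x _ ↦ hg0 x)
  choose U hUo hTU w hw hwT using fun j ↦ happrox j (s j) (hs0 j)
  let v : ℕ → X → ℝ := fun j y ↦ w j y + δ j * (ψ j y - 1 / 2)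
  have hv : ∀ j, ∀ x ∈ U j, ContMDiffAt (𝓡 n) 𝓘(ℝ, ℝ) ∞ (v j) x := fun j x hx ↦
    ((hw j).contMDiffAt ((hUo j).mem_nhds hx)).add
      (contMDiffAt_const.mul ((hψ j).contMDiffAt.sub contMDiffAt_const))
  -- The smoothing errors that affect a point `x` are at most `g x / 2 ^ (j + 1)`, so their sum
  -- never exceeds `g x`.
  let η : ℕ → ℝ := fun j ↦ s j * (1 / 2) ^ (j + 1)
  have hη0 : ∀ j, 0 < η j := fun j ↦ mul_pos (hs0 j) (by positivity)
  have hηs : ∀ j, η j ≤ s j := fun j ↦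
    mul_le_of_le_one_right (hs0 j).le (pow_le_one₀ (by norm_num) (by norm_num))
  choose σ hσ hσ0 hσ1 hσ2 hσpos hσb using fun j ↦ exists_smooth_regularized_posPart (hη0 j)
  let M : ℕ → X → ℝ := fun j ↦ Nat.rec b (fun j m x ↦
    if x ∈ tsupport (ψ j) then m x + σ j (v j x - m x) else m x) j
  have hM0 : M 0 = b := rfl
  have hMs : ∀ j x, M (j + 1) x =
      if x ∈ tsupport (ψ j) then M j x + σ j (v j x - M j x) else M j x := fun _ _ ↦ rfl
  have hMmono : ∀ x, Monotone fun j ↦ M j x := fun x ↦ monotone_nat_of_le_succ fun j ↦ by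
    rw [hMs]
    split_ifs
    · linarith [(hσb j (v j x - M j x)).2.1]
    · exact le_rfl
  have hbM : ∀ j x, b x ≤ M j x := fun j x ↦ hMmono x (Nat.zero_le j)
  have hMu : ∀ j x, M j x ≤ u x + ε x := by
    intro j
    induction j with
    | zero => intro x; rw [hM0]; linarith [(hbu x).2, hgε x, hε0 x]
    | succ j ih =>
      intro x
      rw [hMs]
      split_ifs with hx
      · have h1 := (hσb j (v j x - M j x)).2.2
        have h2 : v j x ≤ u x + s j + δ j / 2 := by
          have : δ j * (ψ j x - 1 / 2) ≤ δ j * (1 / 2) := by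
            gcongr
            · exact (hδ j).le
            · linarith [(hψ01 j x).2]
          simp only [v]
          linarith [(hwT j x hx).2.1]
        have h3 := hsg j x hx
        have h4 := hgε x
        have h5 := hδε j x hx
        have h6 := hηs j
        -- The budget in the second case is `s j + δ j / 2 + η j ≤ ε/4 + ε/2 + ε/4`.
        rcases max_cases 0 (v j x - M j x + η j) with ⟨h, -⟩ | ⟨h, -⟩
        · linarith [ih x]
        · linarith
      · exact ih x
  have hzero : ∀ j, ContMDiff (𝓡 n) 𝓘(ℝ, ℝ) ∞ (M j) → ∀ x, ψ j x = 0 →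
      M (j + 1) =ᶠ[𝓝 x] M j := by
    intro j hMj x hx
    by_cases hxT : x ∈ tsupport (ψ j)
    · have hcont : ContinuousAt (fun y ↦ v j y - M j y) x :=
        (hv j x (hTU j hxT)).continuousAt.sub hMj.continuous.continuousAt
      -- Here `v j ≤ u + g - 4g`, while `M j ≥ b > u - g`; the gap exceeds `2g`, and `η j ≤ g`.
      have hlt : v j x - M j x < -η j := by
        have h1 : v j x = w j x - δ j / 2 := by simp only [v, hx]; ring
        have h2 := (hwT j x hxT).2.1
        linarith [hsg j x hxT, hηs j, hgδ j x hxT, hbM j x, (hbu x).1, hg0 x]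
      filter_upwards [hcont.eventually (gt_mem_nhds hlt)] with y hy
      rw [hMs, hσ0 j _ hy.le, add_zero, ite_self]
    · filter_upwards [(isClosed_tsupport (ψ j)).isOpen_compl.mem_nhds hxT] with y hy
      rw [hMs, if_neg hy]
  have hform : ∀ j x, ψ j x ≠ 0 → M (j + 1) =ᶠ[𝓝 x] fun y ↦ M j y + σ j (v j y - M j y) := by
    intro j x hx
    filter_upwards [(hψ j).continuous.continuousAt.eventually_ne hx] with y hy
    rw [hMs, if_pos (subset_tsupport _ hy)]
  have hformsm : ∀ j, ContMDiff (𝓡 n) 𝓘(ℝ, ℝ) ∞ (M j) → ∀ x, ψ j x ≠ 0 →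
      ContMDiffAt (𝓡 n) 𝓘(ℝ, ℝ) ∞ (fun y ↦ M j y + σ j (v j y - M j y)) x := by
    intro j hMj x hx
    have h := hv j x (hTU j (subset_tsupport _ hx))
    exact hMj.contMDiffAt.add ((hσ j).contMDiff.contMDiffAt.comp x (h.sub hMj.contMDiffAt))
  have hMsm : ∀ j, ContMDiff (𝓡 n) 𝓘(ℝ, ℝ) ∞ (M j) := by
    intro j
    induction j with
    | zero => exact hb
    | succ j ih =>
      intro x
      by_cases hx : ψ j x = 0
      · exact (ih x).congr_of_eventuallyEq (hzero j ih x hx)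
      · exact (hformsm j ih x hx).congr_of_eventuallyEq (hform j x hx)
  have two_le : (2 : WithTop ℕ∞) ≤ ∞ := by norm_cast
  -- Either strictness already holds at `x`, or `M j` has risen above `b` only by accumulated
  -- smoothing errors.
  have hinv : ∀ j x, (∀ W ∈ gFibre G x, κ x ≤ traceOn W (hess (M j) x)) ∨
      M j x ≤ b x + (1 - (1 / 2) ^ j) * g x := by
    intro j
    induction j with
    | zero => intro x; right; simp [hM0]
    | succ j ih =>
      intro x
      have hpow : (1 / 2 : ℝ) ^ j = 2 * (1 / 2) ^ (j + 1) := by rw [pow_succ]; ring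
      have hpow0 : (0 : ℝ) < (1 / 2) ^ (j + 1) := by positivity
      by_cases hx : ψ j x = 0
      · have heq := hzero j (hMsm j) x hx
        rcases ih x with h | h
        · left
          intro W hW
          rw [traceOn_hess_congr heq]
          exact h W hW
        · right
          rw [heq.self_of_nhds]
          rw [hpow] at h
          nlinarith [hg0 x]
      · have hxT := subset_tsupport (ψ j) hx
        have heq := hform j x hx
        have key : ∀ W : Submodule ℝ (Tan n x),
            (1 - deriv (σ j) (v j x - M j x)) * traceOn W (hess (M j) x) +
              deriv (σ j) (v j x - M j x) * traceOn W (hess (v j) x) ≤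
            traceOn W (hess (M (j + 1)) x) := fun W ↦ by
          rw [traceOn_hess_congr heq]
          exact traceOn_le_of_combination W _ _ fun e ↦
            hess_self_regularized_max_ge ((hMsm j x).of_le two_le)
              ((hv j x (hTU j hxT)).of_le two_le) ((hσ j).of_le two_le) (hσ2 j)
              ((hformsm j (hMsm j) x hx).of_le two_le) e
        have hvκ := (hwT j x hxT).2.2
        -- If `v j` wins, only its Hessian counts. Otherwise a strict `M j` gives a convex
        -- combination of two strict traces, and a non-strict one rises by at most `η j`.
        rcases lt_or_ge 0 (v j x - M j x) with hpos | hneg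
        · left
          intro W hW
          have := key W
          rw [(hσpos j _ hpos).1] at this
          have h2 : κ x ≤ traceOn W (hess (v j) x) := hvκ W hW
          linarith
        · rcases ih x with h | h
          · left
            intro W hW
            have h1 := h W hW
            have h2 : κ x ≤ traceOn W (hess (v j) x) := hvκ W hW
            have h3 := hσ1 j (v j x - M j x)
            refine le_trans ?_ (key W)
            nlinarith [mul_le_mul_of_nonneg_left h1 (sub_nonneg.2 h3.2),
              mul_le_mul_of_nonneg_left h2 h3.1]
          · right
            have h1 := (hσb j (v j x - M j x)).2.2
            have h2 : max 0 (v j x - M j x + η j) ≤ η j := max_le (hη0 j).le (by linarith)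
            have h3 : η j ≤ g x * (1 / 2) ^ (j + 1) :=
              mul_le_mul_of_nonneg_right (hsg j x hxT) hpow0.le
            rw [hMs, if_pos hxT]
            rw [hpow] at h
            nlinarith
  obtain ⟨F, hF⟩ := LocallyFinite.exists_forall_eventually_atTop_eventuallyEq (f := M)
    (hlf.subset fun j x hx ↦ by
      by_contra hxT
      exact hx (by rw [hMs, if_neg hxT]))
  -- Near `x` the sequence is eventually constant; beyond an index with `ψ j x = 1` its value is at
  -- least `v j x ≥ u x + 4 * g x`.
  have hcore : ∀ x, ∃ m, M m =ᶠ[𝓝 x] F ∧ u x + 4 * g x ≤ M m x := fun x ↦ by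
    obtain ⟨j, hj⟩ := hψ1 x
    obtain ⟨m, hm, hjm⟩ := ((hF x).and (eventually_ge_atTop (j + 1))).exists
    refine ⟨m, hm, le_trans ?_ (hMmono x hjm)⟩
    have hxT : x ∈ tsupport (ψ j) := subset_tsupport _ (by simp [hj])
    simp only
    rw [hMs, if_pos hxT]
    have h1 := (hσb j (v j x - M j x)).1
    have h2 : v j x = w j x + δ j / 2 := by simp only [v, hj]; ring
    linarith [(hwT j x hxT).1, hgδ j x hxT]
  refine ⟨F, fun x ↦ ?_, fun x W hW ↦ ?_, fun x ↦ ?_⟩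
  · obtain ⟨m, hm, -⟩ := hcore x
    exact (hMsm m x).congr_of_eventuallyEq hm.symm
  · obtain ⟨m, hm, hge⟩ := hcore x
    rw [← traceOn_hess_congr hm]
    -- The other alternative would give `M m x < b x + g x < u x + 2 * g x`, contradicting the lift
    -- by `4 * g x`.
    refine (hinv m x).resolve_right (fun h ↦ ?_) W hW
    have : (0 : ℝ) < (1 / 2) ^ m := by positivity
    nlinarith [(hbu x).2, hg0 x]
  · obtain ⟨m, hm, hge⟩ := hcore x
    rw [← hm.self_of_nhds]
    exact ⟨by linarith [hg0 x], hMu m x⟩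

end GPluri

/-! ### Choice of the tilts and conclusion -/

theorem theorem9p10 {n p : ℕ} (hp : 1 ≤ p) (hpn : p ≤ n)
    {X : Type*} [TopologicalSpace X] [T2Space X] [SecondCountableTopology X]
    [ChartedSpace (EuclideanSpace ℝ (Fin n)) X] [IsManifold (𝓡 n) ∞ X]
    [RiemannianBundle (fun x : X ↦ TangentSpace (𝓡 n) x)]
    [IsContMDiffRiemannianBundle (𝓡 n) ∞ (EuclideanSpace ℝ (Fin n))
      (fun x : X ↦ TangentSpace (𝓡 n) x)]
    (G : Set (GPluri.GrassmannBundle n p X))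
    (hG : GPluri.HasLocalSmoothStrictApproximation G)
    (c ε : X → ℝ) (hc : Continuous c) (hc0 : ∀ x, 0 < c x)
    (hε : Continuous ε) (hε0 : ∀ x, 0 < ε x) (hε1 : ∀ x, ε x < 1)
    (u : X → ℝ) (hu : Continuous u) (hpsh : GPluri.IsPSHOn G u univ)
    (hstrict : GPluri.IsStrictOn G c u univ) :
    ∃ v : X → ℝ, GPluri.IsSmoothPSHOn G v univ ∧
      GPluri.IsStrictOn G (fun x ↦ (1 - ε x) * c x) v univ ∧
      ∀ x, u x ≤ v x ∧ v x ≤ u x + ε x := by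
  have : LocallyCompactSpace X := ChartedSpace.locallyCompactSpace (GPluri.RSp n) X
  have two_le : (2 : WithTop ℕ∞) ≤ ∞ := by norm_cast
  choose U hUo hxU hUapprox using hG
  obtain ⟨ψ, hψ, hψ01, hψc, hlf, hψ1, hψU⟩ :=
    GPluri.exists_smooth_bump_sequence (n := n) U fun x ↦ (hUo x).mem_nhds (hxU x)
  choose C hC0 hC using fun j ↦
    GPluri.exists_abs_traceOn_hess_le G ((hψ j).of_le two_le) (hψc j)
  -- The first bound keeps the tilt within `ε`; the second makes the loss `δ j * C j` at most `ε *
  -- c` on the support.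
  choose δ hδ0 hδ using fun j ↦ IsCompact.exists_pos_forall_le (hψc j)
    (g := fun x ↦ min (ε x) (ε x * c x / C j))
    (hε.min ((hε.mul hc).div_const _)).continuousOn
    (fun x _ ↦ lt_min (hε0 x) (div_pos (mul_pos (hε0 x) (hc0 x)) (hC0 j)))
  obtain ⟨v, hv, hvκ, hvu⟩ := GPluri.exists_smooth_glued G (κ := fun x ↦ (1 - ε x) * c x)
    hu hε hε0 hψ hψ01 hψc hlf hψ1 hδ0 (fun j x hx ↦ (hδ j x hx).trans (min_le_left _ _))
    (fun j s hs ↦ by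
      rcases hψU j with hT | ⟨x₀, hx₀⟩
      · exact ⟨∅, isOpen_empty, hT.le, 0, by simp [ContMDiffOn], by simp [hT]⟩
      · obtain ⟨w, hw, hws, hwu⟩ := hUapprox x₀ c hc hc0 u hu.continuousOn
          ⟨hpsh.1.mono (subset_univ _), fun x _ ↦ hpsh.2 x (mem_univ x)⟩
          (fun x _ ↦ hstrict x (mem_univ x)) _ (hψc j) hx₀ s hs
        refine ⟨U x₀, hUo x₀, hx₀, w, hw.1, fun x hx ↦ ⟨(hwu x hx).1, (hwu x hx).2, ?_⟩⟩
        intro W hW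
        have hwx : ContMDiffAt (𝓡 n) 𝓘(ℝ, ℝ) ∞ w x :=
          (hw.1).contMDiffAt ((hUo x₀).mem_nhds (hx₀ hx))
        have hψx := (hψ j).contMDiffAt (x := x)
        -- A smooth function is its own test function, so viscosity strictness gives the pointwise
        -- trace bound.
        have h1 := hws x (hx₀ hx) w (GPluri.isTestFunction_self (hwx.of_le two_le)) W hW
        have h2 := abs_le.1 (hC j x hx W hW)
        have h3 := GPluri.traceOn_le_of_combination W (B₁ := GPluri.hess w x)
          (B₂ := GPluri.hess (ψ j) x)
          (B := GPluri.hess (fun y ↦ w y + δ j * (ψ j y - 1 / 2)) x) 1 (δ j) (fun e ↦ by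
            rw [one_mul]
            exact (GPluri.hess_self_add_mul (hwx.of_le two_le) (hψx.of_le two_le) (δ j) (1 / 2)
              ((hwx.add (contMDiffAt_const.mul (hψx.sub contMDiffAt_const))).of_le two_le) e).ge)
        have h4 : δ j * C j ≤ ε x * c x :=
          (le_div_iff₀ (hC0 j)).1 ((hδ j x hx).trans (min_le_right _ _))
        have h5 : -(δ j * C j) ≤ δ j * GPluri.traceOn W (GPluri.hess (ψ j) x) := by
          nlinarith [hδ0 j]
        linarith)
  have hnn : ∀ x, 0 ≤ (1 - ε x) * c x := fun x ↦
    mul_nonneg (sub_nonneg.2 (hε1 x).le) (hc0 x).le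
  refine ⟨v, ⟨hv.contMDiffOn, fun x _ W hW ↦ (hnn x).trans (hvκ x W hW)⟩,
    fun x _ φ hφ W hW ↦ (hvκ x W hW).trans ?_, hvu⟩
  exact GPluri.traceOn_mono W fun e ↦
    GPluri.hess_self_le_of_isTestFunction ((hv x).of_le two_le) hφ e
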